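/- **Conventions.** A *box space of graphs* is $X=\bigsqcup_{i\in\mathbb N}X_i$, where $(X_i)$ is a sequence of finite simple graphs (not necessarily connected) of uniformly bounded degree with $|X_i|\to\infty$; $d$ is the graph metric on each connected component of each $X_i$ and $\infty$ otherwise. The Laplace operator $\Delta\in\mathcal B(\ell^2(X))$ is $(\Delta f)(x)=\sum_{y\sim x}(f(x)-f(y))$. The algebraic Roe algebra $\mathbb C[X]$ is the $*$-algebra of all $T\in\mathcal B(\ell^2(X))$ for which there is $R>0$ with $\langle T\delta_x,\delta_y\rangle=0$ whenever $d(x,y)\ge R$. The coarse groupoid is $G(X)=\bigcup_{R>0}\overline{E_R}\subseteq\beta X\times\beta X$, where $E_R=\{(x,y)\in X\times X: d(x,y)\le R\}$ and the closures are taken in $\beta X\times\beta X$ ($\beta X$ being the Stone–Čech compactification of the discrete space $X$), with the operations of the pair groupoid and the weak topology of the union; the boundary groupoid $\partial G(X)$ is its reduction to $\partial\beta X=\beta X\setminus X$. For a Hausdorff étale groupoid $G$ with compact base space, $C_c(G)$ is the $*$-algebra of continuous compactly supported functions with convolution product and $f^*(g)=\overline{f(g^{-1})}$. For a unital $*$-algebra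 $A$ among $\mathbb C[X]$, $C_c(G(X))$, $C_c(\partial G(X))$, its maximal C*-algebra is the completion of $A$ with respect to the (finite) norm $\|a\|=\sup_\pi\|\pi(a)\|$ over all unital $*$-homomorphisms $\pi:A\to\mathcal B(\mathcal H)$, $\mathcal H$ a Hilbert space. Write $C^*_{u,\max}(X)$ for that of $\mathbb C[X]$ and $C^*_{\max}(\partial G(X))$ for that of $C_c(\partial G(X))$. Identifying $\mathbb C[X]$ with $C_c(G(X))$ (by continuous extension of matrix entries from pairs in $X\times X$ to $G(X)$) and restricting functions to $\partial G(X)$, the operator $\Delta\in\mathbb C[X]$ defines elements of both C*-algebras, also denoted $\Delta$. For $c>0$ say that $\Delta$ *has spectral gap of size $c$* in a unital C*-algebra $A$ if $\sigma_A(\Delta)\subseteq\{0\}\cup[c,\infty)$. Then $X$ *is an expander* if $\Delta$ has spectral gap of some size $c>0$ in $\mathcal B(\ell^2(X))$; $X$ *has geometric property (T)* if this holds in $C^*_{u,\max}(X)$; and $X$ *has boundary geometric property (T)* if this holds in $C^*_{\max}(\partial G(X))$. **Proposition 3.1.** Let $X=\bigsqcup_i X_i$ be a box space of graphs. Then $X$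 has geometric property (T) if and only if $X$ is an expander and has boundary geometric property (T). Moreover, the size of the spectral gap is preserved: for every $c>0$, $\Delta$ has spectral gap of size $c$ in $C^*_{u,\max}(X)$ if and only if it has spectral gap of size $c$ both in $\mathcal B(\ell^2(X))$ and in $C^*_{\max}(\partial G(X))$. -/

import Mathlib

open Filter Topology Set
open scoped ENNReal InnerProductSpace

universe u

noncomputable section

/-! ### The maximal C*-completion of a unital *-algebra -/

/-- A representation of a unital complex *-algebra `A`: a unital *-homomorphism into the bounded
operators on a (nonzero) complex Hilbert space. -/
structure StarRep (A : Type u) [Ring A] [Algebra ℂ A] [StarRing A] where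
  H : Type u
  [normed : NormedAddCommGroup H]
  [inner : InnerProductSpace ℂ H]
  [complete : CompleteSpace H]
  [nontrivial : Nontrivial H]
  hom : A →⋆ₐ[ℂ] (H →L[ℂ] H)

attribute [instance] StarRep.normed StarRep.inner StarRep.complete StarRep.nontrivial

/-- The supremum of `‖π(a)‖` over all representations `π` is finite for every `a ∈ A`. -/
class BoundedReps (A : Type u) [Ring A] [Algebra ℂ A] [StarRing A] : Prop where
  bounded : ∀ a : A, ∃ C : ℝ, ∀ π : StarRep A, ‖π.hom a‖ ≤ C

section MaxCStar

variable (A : Type u) [Ring A] [Algebra ℂ A] [StarRing A]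

/-- The C*-algebra of bounded families `(T_π)` of operators indexed by the representations `π` of
`A`, with pointwise operations and the supremum norm. -/
def RepProduct : Type (u + 1) := lp (fun π : StarRep A => π.H →L[ℂ] π.H) ∞

instance : CStarAlgebra (lp (fun π : StarRep A => π.H →L[ℂ] π.H) ∞) where

instance : CStarAlgebra (RepProduct A) :=
  inferInstanceAs (CStarAlgebra (lp (fun π : StarRep A => π.H →L[ℂ] π.H) ∞))

variable [BoundedReps A]

/-- The universal representation `a ↦ (π(a))_π`; `‖universalRep A a‖ = sup_π ‖π(a)‖`. -/
def universalRep : A →⋆ₐ[ℂ] RepProduct A where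
  toFun a := ⟨fun π => π.hom a, memℓp_infty <| by
    obtain ⟨C, hC⟩ := BoundedReps.bounded a
    exact ⟨C, by rintro _ ⟨π, rfl⟩; exact hC π⟩⟩
  map_one' := Subtype.ext (funext fun π => map_one π.hom)
  map_mul' a b := Subtype.ext (funext fun π => map_mul π.hom a b)
  map_zero' := Subtype.ext (funext fun π => map_zero π.hom)
  map_add' a b := Subtype.ext (funext fun π => map_add π.hom a b)
  commutes' c := Subtype.ext (funext fun π => AlgHomClass.commutes π.hom c)
  map_star' a := Subtype.ext (funext fun π => map_star π.hom a)

/-- The maximal C*-algebra of `A`: the completion of `A` with respect to the (semi)norm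
`sup_π ‖π(a)‖`, realized as the norm closure of the image of `A` in the universal
representation. -/
def MaxCStar : Type (u + 1) := (universalRep A).range.topologicalClosure

instance : IsClosed ((universalRep A).range.topologicalClosure : Set (RepProduct A)) :=
  StarSubalgebra.isClosed_topologicalClosure _

instance : CStarAlgebra (MaxCStar A) :=
  inferInstanceAs (CStarAlgebra (universalRep A).range.topologicalClosure)

variable {A}

/-- The canonical map from `A` to its maximal C*-algebra. -/
def toMaxCStar : A →⋆ₐ[ℂ] MaxCStar A :=
  (StarSubalgebra.inclusion (StarSubalgebra.le_topologicalClosure _)).comp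
    (universalRep A).rangeRestrict

end MaxCStar

theorem BoundedReps.of_sum {A : Type u} [Ring A] [Algebra ℂ A] [StarRing A]
    (h : ∀ a : A, ∃ (N : ℕ) (b g : Fin N → A) (M : Fin N → ℝ), a = ∑ k, b k ∧
      ∀ k, star (b k) * b k + star (g k) * g k = (M k : ℂ) • (1 : A)) : BoundedReps A := by
  refine ⟨fun a => ?_⟩
  obtain ⟨N, b, g, M, rfl, hM⟩ := h a
  refine ⟨∑ k, √(M k), fun π => ?_⟩
  rw [map_sum]
  refine (norm_sum_le _ _).trans (Finset.sum_le_sum fun k _ => ?_)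
  refine ContinuousLinearMap.opNorm_le_bound _ (Real.sqrt_nonneg _) fun v => ?_
  have key : ∀ a : A, inner ℂ (π.hom (star a * a) v) v = (‖π.hom a v‖ ^ 2 : ℂ) := by
    intro a
    rw [map_mul, map_star, mul_apply_eq_comp, ContinuousLinearMap.star_eq_adjoint,
      ContinuousLinearMap.adjoint_inner_left, inner_self_eq_norm_sq_to_K]
    rfl
  have h1 : (‖π.hom (b k) v‖ ^ 2 : ℂ) + (‖π.hom (g k) v‖ ^ 2 : ℂ) = (M k : ℂ) * (‖v‖ ^ 2 : ℂ) := by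
    rw [← key, ← key, ← inner_add_left, ← add_apply, ← map_add, hM, map_smul,
      map_one, smul_apply, one_apply_eq_self, inner_smul_left,
      Complex.conj_ofReal, inner_self_eq_norm_sq_to_K]
    rfl
  have h2 : ‖π.hom (b k) v‖ ^ 2 + ‖π.hom (g k) v‖ ^ 2 = M k * ‖v‖ ^ 2 := by exact_mod_cast h1
  have h3 : ‖π.hom (b k) v‖ ^ 2 ≤ M k * ‖v‖ ^ 2 := by
    have := sq_nonneg ‖π.hom (g k) v‖
    linarith
  calc ‖π.hom (b k) v‖ ≤ √(M k * ‖v‖ ^ 2) := Real.le_sqrt_of_sq_le h3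
    _ = √(M k) * ‖v‖ := by
      rw [Real.sqrt_mul' _ (sq_nonneg _), Real.sqrt_sq (norm_nonneg _)]

/-! ### Box spaces -/

/-- A box space of graphs: a sequence of finite graphs `X_i` of uniformly bounded degree with
`|X_i| → ∞`.  The graphs are not required to be connected. -/
structure BoxSpace where
  /-- the vertex set of `X_i` -/
  V : ℕ → Type u
  /-- the edges of `X_i` -/
  graph : ∀ i, SimpleGraph (V i)
  finite : ∀ i, Finite (V i)
  bounded_degree : ∃ d : ℕ, ∀ i v, ((graph i).neighborSet v).ncard ≤ d
  card_tendsto : Tendsto (fun i => Nat.card (V i)) atTop atTop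

namespace BoxSpace

variable (X : BoxSpace.{u})

/-- The underlying set `⨆ᵢ Xᵢ` of the box space. -/
abbrev Pt : Type u := Σ i, X.V i

/-- The disjoint union of the graphs `X_i`, as one graph on `X`.  Its extended graph metric
`X.G.edist` is the graph metric on each connected component of each `X_i`, and `∞` otherwise. -/
def G : SimpleGraph X.Pt where
  Adj p q := ∃ (i : ℕ) (v w : X.V i), (X.graph i).Adj v w ∧ p = ⟨i, v⟩ ∧ q = ⟨i, w⟩
  symm := ⟨fun _ _ ⟨i, v, w, h, hp, hq⟩ => ⟨i, w, v, h.symm, hq, hp⟩⟩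
  loopless := ⟨by
    rintro _ ⟨i, v, w, h, rfl, hq⟩
    obtain rfl : v = w := by simpa using hq
    exact h.ne rfl⟩

theorem neighborSet_eq (i : ℕ) (v : X.V i) :
    X.G.neighborSet ⟨i, v⟩ = Sigma.mk i '' (X.graph i).neighborSet v := by
  ext q
  constructor
  · rintro ⟨j, a, b, h, hp, rfl⟩
    obtain ⟨rfl, h2⟩ := Sigma.mk.inj_iff.1 hp
    obtain rfl := eq_of_heq h2
    exact ⟨b, h, rfl⟩
  · rintro ⟨b, h, rfl⟩
    exact ⟨i, v, b, h, rfl, rfl⟩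

theorem finite_neighborSet (x : X.Pt) : (X.G.neighborSet x).Finite := by
  obtain ⟨i, v⟩ := x
  have := X.finite i
  rw [neighborSet_eq]
  exact (Set.toFinite _).image _

instance locallyFinite : X.G.LocallyFinite := fun x => (X.finite_neighborSet x).fintype

theorem exists_degree_le : ∃ d : ℕ, ∀ x, X.G.degree x ≤ d := by
  obtain ⟨d, hd⟩ := X.bounded_degree
  refine ⟨d, ?_⟩
  rintro ⟨i, v⟩
  have := X.finite i
  rw [← SimpleGraph.card_neighborFinset_eq_degree, ← Set.ncard_coe_finset,
    SimpleGraph.coe_neighborFinset, neighborSet_eq]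
  exact (Set.ncard_image_le (Set.toFinite _)).trans (hd i v)

/-- Balls of a fixed radius have uniformly bounded cardinality. -/
theorem exists_ball_card_le (R : ℕ) :
    ∃ N : ℕ, ∀ x, ∃ s : Finset X.Pt, s.card ≤ N ∧ ∀ y, X.G.edist x y ≤ R → y ∈ s := by
  classical
  obtain ⟨d, hd⟩ := X.exists_degree_le
  induction R with
  | zero =>
    refine ⟨1, fun x => ⟨{x}, by simp, fun y hy => ?_⟩⟩
    rw [Nat.cast_zero, nonpos_iff_eq_zero, SimpleGraph.edist_eq_zero_iff] at hy
    simp [hy]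
  | succ R ih =>
    obtain ⟨N, hN⟩ := ih
    choose s hs hs' using hN
    refine ⟨d * N + 1, fun x => ⟨insert x ((X.G.neighborFinset x).biUnion s), ?_, ?_⟩⟩
    · refine (Finset.card_insert_le _ _).trans (Nat.add_le_add_right ?_ 1)
      refine (Finset.card_biUnion_le_card_mul _ _ N fun z _ => hs z).trans ?_
      exact Nat.mul_le_mul_right _ (hd x)
    · intro y hy
      obtain ⟨p, hp⟩ := SimpleGraph.exists_walk_of_edist_ne_top
        (ne_top_of_le_ne_top (ENat.natCast_ne_top _) hy)
      cases p with
      | nil => simp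
      | @cons _ z _ h p =>
        refine Finset.mem_insert_of_mem (Finset.mem_biUnion.2 ⟨z, by simpa using h, hs' z y ?_⟩)
        refine (SimpleGraph.edist_le p).trans ?_
        rw [← hp, SimpleGraph.Walk.length_cons] at hy
        have : p.length + 1 ≤ R + 1 := by exact_mod_cast hy
        exact_mod_cast (by omega : p.length ≤ R)

/-- For every `S` there is a finite colouring of `X` whose colour classes are `S`-separated. -/
theorem exists_colouring (S : ℕ) : ∃ (N : ℕ) (c : X.Pt → Fin N),
    ∀ x y, X.G.edist x y ≤ S → c x = c y → x = y := by
  classical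
  obtain ⟨N, hN⟩ := X.exists_ball_card_le S
  choose s hs hs' using hN
  let r : X.Pt → X.Pt → Prop := WellOrderingRel
  have wf : WellFounded r := IsWellFounded.wf
  have key : ∀ (x : X.Pt) (f : ∀ y, r y x → Fin (N + 1)),
      ∃ k : Fin (N + 1), ∀ y (h : r y x), y ∈ s x → f y h ≠ k := by
    intro x f
    by_contra! hcon
    choose y hr hy hf using hcon
    have hinj : Function.Injective y := by
      intro a b hab
      rw [← hf a, ← hf b]
      congr 1
    have := Finset.card_le_card_of_injOn (s := Finset.univ) (t := s x) y (fun a _ => hy a)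
      (hinj.injOn)
    simp at this
    have := hs x
    omega
  let c : X.Pt → Fin (N + 1) := wf.fix fun x f => (key x f).choose
  have hc : ∀ x y, r y x → y ∈ s x → c y ≠ c x := by
    intro x y h hy
    have : c x = (key x fun y _ => c y).choose := wf.fix_eq _ x
    rw [this]
    exact (key x fun y _ => c y).choose_spec y h hy
  refine ⟨N + 1, c, fun x y hxy hcxy => ?_⟩
  rcases trichotomous_of r x y with h | h | h
  · exact absurd hcxy (hc y x h (hs' y x (by rwa [SimpleGraph.edist_comm])))
  · exact h
  · exact absurd hcxy.symm (hc x y h (hs' x y hxy))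

/-! ### The coarse groupoid -/

/-- The Stone-Čech compactification `βX` of the discrete space `X`, as the space of ultrafilters;
points of `X` are the principal ultrafilters `pure x`. -/
abbrev Beta : Type u := Ultrafilter X.Pt

/-- The controlled set `E_R = {(x, y) | d(x, y) ≤ R}`. -/
def entourage (R : ℕ) : Set (X.Pt × X.Pt) := {p | X.G.edist p.1 p.2 ≤ R}

/-- The closure of (the image of) a set of pairs in `βX × βX`. -/
def cl (W : Set (X.Pt × X.Pt)) : Set (X.Beta × X.Beta) :=
  closure ((fun p => (pure p.1, pure p.2)) '' W)

/-- The coarse groupoid `G(X) = ⋃ R, cl E_R ⊆ βX × βX`.  It is a subgroupoid of the pair groupoid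
`βX × βX`: the element `(ω, η)` has range `ω` and source `η`, and `(ω, ζ)(ζ, η) = (ω, η)`. -/
structure CoarseGroupoid where
  val : X.Beta × X.Beta
  exists_mem : ∃ R : ℕ, val ∈ X.cl (X.entourage R)

variable {X}

namespace CoarseGroupoid

def range (g : X.CoarseGroupoid) : X.Beta := g.1.1

def source (g : X.CoarseGroupoid) : X.Beta := g.1.2

/-- The inclusion of `cl E_R`. -/
def incl (R : ℕ) (p : X.cl (X.entourage R)) : X.CoarseGroupoid := ⟨p.1, R, p.2⟩

/-- The weak topology on the union `G(X) = ⋃ R, cl E_R`: a set is open if and only if its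
intersection with each `cl E_R` is open in `cl E_R ⊆ βX × βX`. -/
instance : TopologicalSpace X.CoarseGroupoid :=
  ⨆ R : ℕ, TopologicalSpace.coinduced (incl R) inferInstance

end CoarseGroupoid

theorem continuous_marginals : Continuous fun Ω : Ultrafilter (X.Pt × X.Pt) =>
    ((Ω.map Prod.fst, Ω.map Prod.snd) : X.Beta × X.Beta) := by
  refine Continuous.prodMk ?_ ?_ <;>
  · refine ultrafilterBasis_is_basis.continuous_iff.2 ?_
    rintro _ ⟨s, rfl⟩
    exact ultrafilter_isOpen_basic _

theorem mem_cl_iff {W : Set (X.Pt × X.Pt)} {g : X.Beta × X.Beta} :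
    g ∈ X.cl W ↔ ∃ Ω : Ultrafilter (X.Pt × X.Pt), W ∈ Ω ∧ (Ω.map Prod.fst, Ω.map Prod.snd) = g := by
  constructor
  · have hK : IsClosed ((fun Ω : Ultrafilter (X.Pt × X.Pt) =>
        ((Ω.map Prod.fst, Ω.map Prod.snd) : X.Beta × X.Beta)) '' {Ω | W ∈ Ω}) :=
      ((ultrafilter_isClosed_basic W).isCompact.image continuous_marginals).isClosed
    intro hg
    obtain ⟨Ω, h1, h2⟩ := closure_minimal (by
      rintro _ ⟨p, hp, rfl⟩
      exact ⟨pure p, hp, by simp [Ultrafilter.map_pure]⟩) hK hg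
    exact ⟨Ω, h1, h2⟩
  · rintro ⟨Ω, hW, rfl⟩
    have h := (continuous_marginals (X := X)).continuousAt.tendsto.comp
      (Ultrafilter.tendsto_pure_self Ω)
    refine mem_closure_of_tendsto h (Filter.mem_of_superset hW fun p hp => ⟨p, hp, ?_⟩)
    simp [Ultrafilter.map_pure]

variable (X) in
/-- Partial translations: if `d(x, y) ≤ S`, then `y` is determined by `x` and the colour of `y`. -/
theorem exists_translations (S : ℕ) : ∃ (N : ℕ) (c : X.Pt → Fin N) (t : Fin N → X.Pt → X.Pt),
    (∀ x y, X.G.edist x y ≤ S → t (c y) x = y) ∧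
    (∀ x y, X.G.edist x y ≤ (S + S : ℕ) → c x = c y → x = y) := by
  classical
  obtain ⟨N, c, hc⟩ := X.exists_colouring (S + S)
  refine ⟨N, c, fun k x => if h : ∃ y, X.G.edist x y ≤ S ∧ c y = k then h.choose else x, ?_, hc⟩
  intro x y hxy
  have h : ∃ y', X.G.edist x y' ≤ S ∧ c y' = c y := ⟨y, hxy, rfl⟩
  simp only [dif_pos h]
  refine hc _ _ ?_ h.choose_spec.2
  refine (SimpleGraph.edist_triangle (v := x)).trans ?_
  rw [SimpleGraph.edist_comm, Nat.cast_add]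
  exact add_le_add h.choose_spec.1 hxy

theorem exists_colour {α : Type*} {N : ℕ} (c : α → Fin N) (η : Ultrafilter α) :
    ∃ k, ∀ᶠ y in (η : Filter α), c y = k := by
  obtain ⟨k, hk⟩ := Ultrafilter.eq_pure_of_finite (η.map c)
  refine ⟨k, ?_⟩
  have : ({k} : Set (Fin N)) ∈ η.map c := by rw [hk]; exact Set.mem_singleton k
  exact this

theorem eq_map_translation {S N : ℕ} {c : X.Pt → Fin N} {t : Fin N → X.Pt → X.Pt}
    (ht : ∀ x y, X.G.edist x y ≤ S → t (c y) x = y) {Ω : Ultrafilter (X.Pt × X.Pt)}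
    (hΩ : X.entourage S ∈ Ω) {k : Fin N} (hk : ∀ᶠ y in (Ω.map Prod.snd : Filter X.Pt), c y = k) :
    Ω = (Ω.map Prod.fst).map fun x => (x, t k x) := by
  rw [Ultrafilter.map_map]
  refine Ultrafilter.coe_injective ?_
  rw [Ultrafilter.coe_map]
  refine Filter.map_id.symm.trans ?_
  refine Filter.map_congr ?_
  filter_upwards [hΩ, show ∀ᶠ p in (Ω : Filter (X.Pt × X.Pt)), c p.2 = k from hk] with p hp hpk
  have := ht p.1 p.2 hp
  rw [hpk] at this
  simp [this]

theorem eq_of_marginals {S : ℕ} {Ω Ω' : Ultrafilter (X.Pt × X.Pt)} (h : X.entourage S ∈ Ω)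
    (h' : X.entourage S ∈ Ω') (h1 : Ω.map Prod.fst = Ω'.map Prod.fst)
    (h2 : Ω.map Prod.snd = Ω'.map Prod.snd) : Ω = Ω' := by
  obtain ⟨N, c, t, ht, -⟩ := X.exists_translations S
  obtain ⟨k, hk⟩ := exists_colour c (Ω.map Prod.snd)
  rw [eq_map_translation ht h hk, eq_map_translation ht h' (h2 ▸ hk), h1]

theorem entourage_mono {R S : ℕ} (h : R ≤ S) : X.entourage R ⊆ X.entourage S :=
  fun p hp => le_trans (show X.G.edist p.1 p.2 ≤ R from hp) (by exact_mod_cast h)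

/-- A point `(ω, η)` lies in `cl E_R` iff `η` is the image of `ω` under a map moving
`ω`-almost every point by at most `R`. -/
theorem mem_cl_entourage_iff {R : ℕ} {ω η : X.Beta} : (ω, η) ∈ X.cl (X.entourage R) ↔
    ∃ t : X.Pt → X.Pt, η = ω.map t ∧ ∀ᶠ x in (ω : Filter X.Pt), X.G.edist x (t x) ≤ R := by
  rw [mem_cl_iff]
  constructor
  · rintro ⟨Ω, hΩ, h⟩
    obtain ⟨N, c, t, ht, -⟩ := X.exists_translations R
    obtain ⟨k, hk⟩ := exists_colour c (Ω.map Prod.snd)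
    have h0 := eq_map_translation ht hΩ hk
    obtain ⟨rfl, rfl⟩ := Prod.mk.inj h
    refine ⟨t k, ?_, ?_⟩
    · conv_lhs => rw [h0]
      rw [Ultrafilter.map_map]; rfl
    · rw [h0] at hΩ
      exact hΩ
  · rintro ⟨t, rfl, h⟩
    exact ⟨ω.map fun x => (x, t x), h, by rw [Ultrafilter.map_map, Ultrafilter.map_map]; rfl⟩

theorem cl_entourage_comp {R S : ℕ} {ω ζ η : X.Beta} (h : (ω, ζ) ∈ X.cl (X.entourage R))
    (h' : (ζ, η) ∈ X.cl (X.entourage S)) : (ω, η) ∈ X.cl (X.entourage (R + S)) := by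
  rw [mem_cl_entourage_iff] at *
  obtain ⟨t, rfl, ht⟩ := h
  obtain ⟨t', rfl, ht'⟩ := h'
  refine ⟨t' ∘ t, by rw [Ultrafilter.map_map], ?_⟩
  filter_upwards [ht, show ∀ᶠ x in (ω : Filter X.Pt), X.G.edist (t x) (t' (t x)) ≤ S from ht']
    with x hx hx'
  rw [Nat.cast_add]
  exact (SimpleGraph.edist_triangle (v := t x)).trans (add_le_add hx hx')

theorem cl_entourage_symm {R : ℕ} {ω η : X.Beta} (h : (ω, η) ∈ X.cl (X.entourage R)) :
    (η, ω) ∈ X.cl (X.entourage R) := by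
  rw [mem_cl_iff] at *
  obtain ⟨Ω, hΩ, h⟩ := h
  obtain ⟨rfl, rfl⟩ := Prod.mk.inj h
  refine ⟨Ω.map Prod.swap, ?_, by rw [Ultrafilter.map_map, Ultrafilter.map_map]; rfl⟩
  change Prod.swap ⁻¹' X.entourage R ∈ Ω
  refine Filter.mem_of_superset hΩ fun p hp => ?_
  change X.G.edist p.2 p.1 ≤ R
  rw [SimpleGraph.edist_comm]
  exact hp

theorem mem_cl_entourage_zero {ω η : X.Beta} : (ω, η) ∈ X.cl (X.entourage 0) ↔ ω = η := by
  rw [mem_cl_entourage_iff]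
  constructor
  · rintro ⟨t, rfl, h⟩
    have : ω.map t = ω.map id := by
      refine Ultrafilter.coe_injective ?_
      rw [Ultrafilter.coe_map, Ultrafilter.coe_map]
      refine Filter.map_congr ?_
      filter_upwards [h] with x hx
      rw [Nat.cast_zero, nonpos_iff_eq_zero, SimpleGraph.edist_eq_zero_iff] at hx
      simp [← hx]
    rw [this, Ultrafilter.map_id]
  · rintro rfl
    exact ⟨id, (Ultrafilter.map_id _).symm, by simp⟩

theorem finite_fibre (R : ℕ) (ω : X.Beta) : {η | (ω, η) ∈ X.cl (X.entourage R)}.Finite := by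
  obtain ⟨N, c, t, ht, -⟩ := X.exists_translations R
  refine (Set.finite_range fun k => ω.map (t k)).subset ?_
  intro η h
  obtain ⟨Ω, hΩ, h⟩ := mem_cl_iff.1 h
  obtain ⟨k, hk⟩ := exists_colour c (Ω.map Prod.snd)
  have h0 := eq_map_translation ht hΩ hk
  obtain ⟨rfl, rfl⟩ := Prod.mk.inj h
  refine ⟨k, ?_⟩
  conv_rhs => rw [h0]
  simp only [Ultrafilter.map_map]; rfl

namespace CoarseGroupoid

theorem exists_lift (g : X.CoarseGroupoid) : ∃ Ω : Ultrafilter (X.Pt × X.Pt),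
    (∃ R, X.entourage R ∈ Ω) ∧ (Ω.map Prod.fst, Ω.map Prod.snd) = g.1 := by
  obtain ⟨R, hR⟩ := g.2
  obtain ⟨Ω, h1, h2⟩ := mem_cl_iff.1 hR
  exact ⟨Ω, ⟨R, h1⟩, h2⟩

/-- The unique ultrafilter on `X × X` that contains a controlled set and has marginals `(ω, η)`;
along it the pairs `(x, y) ∈ X × X` of bounded distance converge to `(ω, η)` in `G(X)`. -/
def lift (g : X.CoarseGroupoid) : Ultrafilter (X.Pt × X.Pt) := g.exists_lift.choose

theorem lift_marginals (g : X.CoarseGroupoid) :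
    (g.lift.map Prod.fst, g.lift.map Prod.snd) = g.1 := g.exists_lift.choose_spec.2

theorem lift_eq (g : X.CoarseGroupoid) {Ω : Ultrafilter (X.Pt × X.Pt)} {R : ℕ}
    (hR : X.entourage R ∈ Ω) (h : (Ω.map Prod.fst, Ω.map Prod.snd) = g.1) : g.lift = Ω := by
  obtain ⟨S, hS⟩ := g.exists_lift.choose_spec.1
  have h2 := g.lift_marginals.trans h.symm
  exact eq_of_marginals (S := max R S)
    (Filter.mem_of_superset hS (entourage_mono (le_max_right _ _)))
    (Filter.mem_of_superset hR (entourage_mono (le_max_left _ _)))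
    (Prod.mk.inj h2).1 (Prod.mk.inj h2).2

theorem entourage_mem_lift {g : X.CoarseGroupoid} {R : ℕ} :
    X.entourage R ∈ g.lift ↔ g.1 ∈ X.cl (X.entourage R) := by
  rw [mem_cl_iff]
  constructor
  · exact fun h => ⟨g.lift, h, g.lift_marginals⟩
  · rintro ⟨Ω, h, h'⟩
    rwa [g.lift_eq h h']

theorem continuous_incl (R : ℕ) : Continuous (incl (X := X) R) :=
  continuous_iff_coinduced_le.2 (le_iSup (fun R : ℕ => TopologicalSpace.coinduced
    (incl (X := X) R) inferInstance) R)

theorem continuous_dom {Y : Type*} [TopologicalSpace Y] {f : X.CoarseGroupoid → Y}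
    (h : ∀ R, Continuous (f ∘ incl R)) : Continuous f := by
  refine continuous_iSup_dom.2 fun R => continuous_coinduced_dom.2 (h R)

theorem continuous_val : Continuous fun g : X.CoarseGroupoid => g.1 :=
  continuous_dom fun _ => continuous_subtype_val

theorem continuous_lift : Continuous (lift (X := X)) := by
  refine continuous_dom fun R => ?_
  let m : {Ω : Ultrafilter (X.Pt × X.Pt) // X.entourage R ∈ Ω} → X.cl (X.entourage R) :=
    fun Ω => ⟨(Ω.1.map Prod.fst, Ω.1.map Prod.snd), mem_cl_iff.2 ⟨Ω.1, Ω.2, rfl⟩⟩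
  have hm : Continuous m := (continuous_marginals.comp continuous_subtype_val).subtype_mk _
  have : CompactSpace {Ω : Ultrafilter (X.Pt × X.Pt) // X.entourage R ∈ Ω} :=
    isCompact_iff_compactSpace.1 (ultrafilter_isClosed_basic _).isCompact
  have hs : Function.Surjective m := by
    rintro ⟨g, hg⟩
    obtain ⟨Ω, h, rfl⟩ := mem_cl_iff.1 hg
    exact ⟨⟨Ω, h⟩, rfl⟩
  rw [(hm.isClosedMap.isQuotientMap hm hs).continuous_iff]
  have : (lift ∘ incl R) ∘ m = Subtype.val := by
    funext Ω
    exact lift_eq _ Ω.2 rfl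
  rw [this]
  exact continuous_subtype_val

theorem isClopen_lift (W : Set (X.Pt × X.Pt)) : IsClopen {g : X.CoarseGroupoid | W ∈ g.lift} :=
  ⟨(ultrafilter_isClosed_basic W).preimage continuous_lift,
    (ultrafilter_isOpen_basic W).preimage continuous_lift⟩

/-- A map into `G(X)` with values in a fixed `cl E_R` is continuous if its coordinates are. -/
theorem continuous_of_bounded {Y : Type*} [TopologicalSpace Y] {φ : Y → X.CoarseGroupoid} {R : ℕ}
    (h1 : Continuous fun y => (φ y).1) (hR : ∀ y, (φ y).1 ∈ X.cl (X.entourage R)) :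
    Continuous φ :=
  (continuous_incl R).comp (h1.subtype_mk hR)

theorem isCompact_cl (R : ℕ) : IsCompact {g : X.CoarseGroupoid | g.1 ∈ X.cl (X.entourage R)} := by
  have : CompactSpace (X.cl (X.entourage R)) := isCompact_iff_compactSpace.1 isClosed_closure.isCompact
  convert! isCompact_range (continuous_incl (X := X) R)
  ext g
  exact ⟨fun h => ⟨⟨g.1, h⟩, rfl⟩, by rintro ⟨p, rfl⟩; exact p.2⟩

end CoarseGroupoid

/-! ### Reductions of the coarse groupoid and their groupoid algebras -/

variable (X) in
/-- A closed invariant subset `Z` of the base space `βX` of `G(X)`. -/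
structure InvariantSet where
  carrier : Set X.Beta
  isClosed : IsClosed carrier
  invariant : ∀ g : X.CoarseGroupoid, g.source ∈ carrier ↔ g.range ∈ carrier

/-- The reduction `G(X)|_Z`, with the subspace topology. -/
abbrev Reduction (Z : X.InvariantSet) : Type u :=
  {g : X.CoarseGroupoid // g.range ∈ Z.carrier ∧ g.source ∈ Z.carrier}

/-- The groupoid algebra `C_c(G(X)|_Z)` of continuous compactly supported functions on
`G(X)|_Z`; its multiplication is convolution. -/
structure GroupoidAlgebra (Z : X.InvariantSet) where
  toFun : Reduction Z → ℂ
  continuous : Continuous toFun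
  hasCompactSupport : HasCompactSupport toFun

/-- The extension of `f ∈ C_c(G(X)|_Z)` by zero to `βX × βX`. -/
def ext0 {Z : X.InvariantSet} (f : GroupoidAlgebra Z) (ω η : X.Beta) : ℂ :=
  open Classical in
  if h : (∃ R : ℕ, (ω, η) ∈ X.cl (X.entourage R)) ∧ ω ∈ Z.carrier ∧ η ∈ Z.carrier then
    f.toFun ⟨⟨(ω, η), h.1⟩, h.2⟩ else 0

namespace GroupoidAlgebra

variable {Z : X.InvariantSet}

instance : CoeFun (GroupoidAlgebra Z) (fun _ => Reduction Z → ℂ) := ⟨toFun⟩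

@[ext] theorem ext {f g : GroupoidAlgebra Z} (h : ∀ x, f x = g x) : f = g := by
  cases f; cases g; congr; exact funext h

instance : Zero (GroupoidAlgebra Z) := ⟨⟨fun _ => 0, continuous_const, HasCompactSupport.zero⟩⟩

instance : Add (GroupoidAlgebra Z) :=
  ⟨fun f g => ⟨fun x => f x + g x, f.continuous.add g.continuous,
    f.hasCompactSupport.add g.hasCompactSupport⟩⟩

instance : Neg (GroupoidAlgebra Z) :=
  ⟨fun f => ⟨fun x => -f x, f.continuous.neg, f.hasCompactSupport.comp_left neg_zero⟩⟩

instance : SMul ℂ (GroupoidAlgebra Z) :=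
  ⟨fun c f => ⟨fun x => c * f x, f.continuous.const_mul c,
    f.hasCompactSupport.comp_left (mul_zero c)⟩⟩

theorem zero_apply (x : Reduction Z) : (0 : GroupoidAlgebra Z) x = 0 := rfl
theorem add_apply (f g : GroupoidAlgebra Z) (x : Reduction Z) : (f + g) x = f x + g x := rfl
theorem neg_apply (f : GroupoidAlgebra Z) (x : Reduction Z) : (-f) x = -f x := rfl
theorem smul_apply (c : ℂ) (f : GroupoidAlgebra Z) (x : Reduction Z) : (c • f) x = c * f x := rfl

instance : AddCommGroup (GroupoidAlgebra Z) where
  add_assoc _ _ _ := ext fun _ => add_assoc _ _ _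
  zero_add _ := ext fun _ => zero_add _
  add_zero _ := ext fun _ => add_zero _
  add_comm _ _ := ext fun _ => add_comm _ _
  neg_add_cancel _ := ext fun _ => neg_add_cancel _
  nsmul := nsmulRec
  zsmul := zsmulRec

instance : Module ℂ (GroupoidAlgebra Z) where
  one_smul _ := ext fun _ => one_mul _
  mul_smul _ _ _ := ext fun _ => mul_assoc _ _ _
  smul_zero _ := ext fun _ => mul_zero _
  smul_add _ _ _ := ext fun _ => mul_add _ _ _
  add_smul _ _ _ := ext fun _ => add_mul _ _ _
  zero_smul _ := ext fun _ => zero_mul _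

theorem ext0_coe (f : GroupoidAlgebra Z) (g : Reduction Z) : ext0 f g.1.1.1 g.1.1.2 = f g :=
  dif_pos (⟨g.1.2, g.2⟩ : (∃ R : ℕ, (g.1.1.1, g.1.1.2) ∈ X.cl (X.entourage R)) ∧ _)

theorem exists_of_ext0_ne {f : GroupoidAlgebra Z} {ω η : X.Beta} (h : ext0 f ω η ≠ 0) :
    ∃ g : Reduction Z, g.1.1 = (ω, η) ∧ f g ≠ 0 := by
  unfold ext0 at h
  split_ifs at h with h'
  · exact ⟨⟨⟨(ω, η), h'.1⟩, h'.2⟩, rfl, h⟩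
  · exact absurd rfl h

theorem hasCompactSupport_iff {f : Reduction Z → ℂ} : HasCompactSupport f ↔
    ∃ R : ℕ, ∀ g, f g ≠ 0 → g.1.1 ∈ X.cl (X.entourage R) := by
  constructor
  · intro h
    obtain ⟨R, hR⟩ := h.isCompact.elim_directed_cover
      (fun R : ℕ => {g : Reduction Z | X.entourage R ∈ g.1.lift})
      (fun R => (CoarseGroupoid.isClopen_lift _).2.preimage continuous_subtype_val)
      (fun g _ => by
        obtain ⟨R, hR⟩ := g.1.2
        exact Set.mem_iUnion.2 ⟨R, CoarseGroupoid.entourage_mem_lift.2 hR⟩)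
      (Monotone.directed_le fun R S h g hg => Filter.mem_of_superset hg (entourage_mono h))
    exact ⟨R, fun g hg => CoarseGroupoid.entourage_mem_lift.1 (hR (subset_tsupport f hg))⟩
  · rintro ⟨R, hR⟩
    have hZ : IsClosed {g : X.CoarseGroupoid | g.range ∈ Z.carrier ∧ g.source ∈ Z.carrier} :=
      (Z.isClosed.preimage (continuous_fst.comp CoarseGroupoid.continuous_val)).inter
        (Z.isClosed.preimage (continuous_snd.comp CoarseGroupoid.continuous_val))
    have hK := hZ.isClosedEmbedding_subtypeVal.isCompact_preimage (CoarseGroupoid.isCompact_cl R)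
    refine HasCompactSupport.intro' hK ?_ fun g hg => by_contra fun h => hg (hR g h)
    exact (isClosed_closure.preimage CoarseGroupoid.continuous_val).preimage continuous_subtype_val

/-- Continuous functions supported in some `cl E_R` have compact support. -/
def ofBounded (f : Reduction Z → ℂ) (hf : Continuous f) (R : ℕ)
    (hR : ∀ g, f g ≠ 0 → g.1.1 ∈ X.cl (X.entourage R)) : GroupoidAlgebra Z :=
  ⟨f, hf, hasCompactSupport_iff.2 ⟨R, hR⟩⟩

theorem exists_support (f : GroupoidAlgebra Z) :
    ∃ R : ℕ, ∀ ω η, ext0 f ω η ≠ 0 → (ω, η) ∈ X.cl (X.entourage R) := by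
  obtain ⟨R, hR⟩ := hasCompactSupport_iff.1 f.hasCompactSupport
  refine ⟨R, fun ω η h => ?_⟩
  obtain ⟨g, hg, hfg⟩ := exists_of_ext0_ne h
  exact hg ▸ hR g hfg

theorem finite_row (f : GroupoidAlgebra Z) (ω : X.Beta) : {ζ | ext0 f ω ζ ≠ 0}.Finite := by
  obtain ⟨R, hR⟩ := f.exists_support
  exact (finite_fibre R ω).subset fun ζ h => hR ω ζ h

theorem finite_col (f : GroupoidAlgebra Z) (η : X.Beta) : {ζ | ext0 f ζ η ≠ 0}.Finite := by
  obtain ⟨R, hR⟩ := f.exists_support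
  exact (finite_fibre R η).subset fun ζ h => cl_entourage_symm (hR ζ η h)

/-- The convolution `(f₁ * f₂)(ω, η) = ∑_ζ f₁(ω, ζ) f₂(ζ, η)`, where the sum is over all
factorizations `(ω, η) = (ω, ζ)(ζ, η)` in `G(X)|_Z`. -/
def conv (f₁ f₂ : GroupoidAlgebra Z) (g : Reduction Z) : ℂ :=
  ∑ᶠ ζ : X.Beta, ext0 f₁ g.1.range ζ * ext0 f₂ ζ g.1.source

theorem conv_support (f₁ f₂ : GroupoidAlgebra Z) :
    ∃ R : ℕ, ∀ g, conv f₁ f₂ g ≠ 0 → g.1.1 ∈ X.cl (X.entourage R) := by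
  obtain ⟨R, hR⟩ := f₁.exists_support
  obtain ⟨S, hS⟩ := f₂.exists_support
  refine ⟨R + S, fun g hg => ?_⟩
  obtain ⟨ζ, hζ⟩ : ∃ ζ : X.Beta, ext0 f₁ g.1.range ζ * ext0 f₂ ζ g.1.source ≠ 0 := by
    by_contra! h
    exact hg ((finsum_congr h).trans finsum_zero)
  exact cl_entourage_comp (hR _ _ (left_ne_zero_of_mul hζ)) (hS _ _ (right_ne_zero_of_mul hζ))

theorem continuous_map (t : X.Pt → X.Pt) : Continuous fun ω : X.Beta => (ω.map t : X.Beta) := by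
  refine ultrafilterBasis_is_basis.continuous_iff.2 ?_
  rintro _ ⟨s, rfl⟩
  exact ultrafilter_isOpen_basic _

theorem continuous_conv (f₁ f₂ : GroupoidAlgebra Z) : Continuous (conv f₁ f₂) := by
  classical
  obtain ⟨R, hR⟩ := f₁.exists_support
  obtain ⟨N, c, t, ht, hc⟩ := X.exists_translations R
  -- the domain of the partial translation with colour `k`
  let A : Fin N → Set X.Pt := fun k => {x | X.G.edist x (t k x) ≤ R ∧ c (t k x) = k}
  have hsum : ∀ g : Reduction Z, conv f₁ f₂ g = ∑ k : Fin N, if A k ∈ g.1.range then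
      ext0 f₁ g.1.range (g.1.range.map (t k)) * ext0 f₂ (g.1.range.map (t k)) g.1.source
      else 0 := by
    intro g
    set ω := g.1.range
    have hinj : ∀ k l, A k ∈ ω → A l ∈ ω → ω.map (t k) = ω.map (t l) → k = l := by
      intro k l hk hl h
      have h1 : {x | c (t k x) = k} ∈ ω :=
        Filter.mem_of_superset (show A k ∈ (ω : Filter X.Pt) from hk) fun x (hx : x ∈ A k) => hx.2
      have h2 : {x | c (t l x) = l} ∈ ω :=
        Filter.mem_of_superset (show A l ∈ (ω : Filter X.Pt) from hl) fun x (hx : x ∈ A l) => hx.2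
      replace h1 : {y | c y = k} ∈ ω.map (t k) := h1
      replace h2 : {y | c y = l} ∈ ω.map (t l) := h2
      rw [h] at h1
      obtain ⟨y, hy1, hy2⟩ := Ultrafilter.nonempty_of_mem (Filter.inter_mem h1 h2)
      exact hy1.symm.trans hy2
    rw [← Finset.sum_filter, conv]
    rw [finsum_eq_sum_of_support_subset (s := (Finset.univ.filter fun k => A k ∈ ω).image
      fun k => ω.map (t k))]
    · refine Finset.sum_image fun k hk l hl h => ?_
      exact hinj k l (by simpa using hk) (by simpa using hl) h
    · intro ζ hζ
      have h0 := hR _ _ (left_ne_zero_of_mul hζ)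
      obtain ⟨Ω, hΩ, h⟩ := mem_cl_iff.1 h0
      obtain ⟨k, hk⟩ := exists_colour c (Ω.map Prod.snd)
      have h1 := eq_map_translation ht hΩ hk
      obtain ⟨h2, rfl⟩ := Prod.mk.inj h
      rw [h2] at h1
      have h3 : Ω.map Prod.snd = ω.map (t k) := by
        conv_lhs => rw [h1]
        rw [Ultrafilter.map_map]; rfl
      rw [h3]
      simp only [Finset.coe_image, Finset.coe_filter, Finset.mem_univ, true_and]
      refine ⟨k, ?_, rfl⟩
      have h4 : ∀ᶠ x in (ω : Filter X.Pt), c (t k x) = k := by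
        rw [h3] at hk; exact hk
      have h5 : ∀ᶠ x in (ω : Filter X.Pt), X.G.edist x (t k x) ≤ R := by
        rw [h1] at hΩ; exact hΩ
      exact h5.and h4
  rw [funext hsum]
  refine continuous_finsetSum _ fun k _ => ?_
  rw [continuous_iff_continuousAt]
  intro g₀
  have hcl : IsClopen {g : Reduction Z | A k ∈ g.1.range} :=
    IsClopen.preimage ⟨ultrafilter_isClosed_basic (A k), ultrafilter_isOpen_basic (A k)⟩
      (continuous_fst.comp (CoarseGroupoid.continuous_val.comp continuous_subtype_val))
  by_cases hA : A k ∈ g₀.1.range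
  · obtain ⟨S, hS⟩ := g₀.1.2
    -- an open neighbourhood on which both factors are continuous
    let U : Set (Reduction Z) := {g | A k ∈ g.1.range} ∩ {g | X.entourage S ∈ g.1.lift}
    have hU : IsOpen U := hcl.2.inter
      ((CoarseGroupoid.isClopen_lift _).2.preimage continuous_subtype_val)
    have hg₀ : g₀ ∈ U := ⟨hA, CoarseGroupoid.entourage_mem_lift.2 hS⟩
    refine ContinuousOn.continuousAt (s := U) ?_ (hU.mem_nhds hg₀)
    rw [continuousOn_iff_continuous_domRestrict]
    have hval : Continuous fun g : U => g.1.1.1 :=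
      CoarseGroupoid.continuous_val.comp (continuous_subtype_val.comp continuous_subtype_val)
    have hfst : Continuous fun g : U => g.1.1.1.1 := continuous_fst.comp hval
    have hsnd : Continuous fun g : U => g.1.1.1.2 := continuous_snd.comp hval
    have e1 : ∀ g : U, (g.1.1.1.1, g.1.1.1.1.map (t k)) ∈ X.cl (X.entourage R) := fun g =>
      mem_cl_entourage_iff.2 ⟨t k, rfl, Filter.mem_of_superset g.2.1 fun x hx => hx.1⟩
    have e2 : ∀ g : U, (g.1.1.1.1.map (t k), g.1.1.1.2) ∈ X.cl (X.entourage (R + S)) := fun g =>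
      cl_entourage_comp (cl_entourage_symm (e1 g)) (CoarseGroupoid.entourage_mem_lift.1 g.2.2)
    have e3 : ∀ g : U, g.1.1.1.1.map (t k) ∈ Z.carrier := fun g =>
      (Z.invariant ⟨_, R, e1 g⟩).2 g.1.2.1
    have hmap : Continuous fun g : U => (g.1.1.1.1.map (t k) : X.Beta) :=
      (continuous_map (t k)).comp hfst
    let φ₁ : U → Reduction Z := fun g => ⟨⟨_, R, e1 g⟩, g.1.2.1, e3 g⟩
    let φ₂ : U → Reduction Z := fun g => ⟨⟨_, R + S, e2 g⟩, e3 g, g.1.2.2⟩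
    have c1 : Continuous φ₁ := Continuous.subtype_mk (CoarseGroupoid.continuous_of_bounded
      (φ := fun g => ⟨_, R, e1 g⟩) (hfst.prodMk hmap) e1) _
    have c2 : Continuous φ₂ := Continuous.subtype_mk (CoarseGroupoid.continuous_of_bounded
      (φ := fun g => ⟨_, R + S, e2 g⟩) (hmap.prodMk hsnd) e2) _
    refine ((f₁.continuous.comp c1).mul (f₂.continuous.comp c2)).congr fun g => ?_
    refine Eq.trans ?_ (if_pos (show A k ∈ g.1.1.range from g.2.1)).symm
    exact congrArg₂ (· * ·) (ext0_coe f₁ (φ₁ g)).symm (ext0_coe f₂ (φ₂ g)).symm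
  · refine ContinuousAt.congr (f := fun _ => (0 : ℂ)) continuousAt_const ?_
    filter_upwards [hcl.compl.2.mem_nhds hA] with g hg
    exact (if_neg hg).symm

instance : Mul (GroupoidAlgebra Z) :=
  ⟨fun f₁ f₂ => ⟨conv f₁ f₂, continuous_conv f₁ f₂, hasCompactSupport_iff.2 (conv_support f₁ f₂)⟩⟩

theorem isClopen_cl (R : ℕ) : IsClopen {g : Reduction Z | g.1.1 ∈ X.cl (X.entourage R)} := by
  have h := (CoarseGroupoid.isClopen_lift (X.entourage R)).preimage
    (continuous_subtype_val (p := fun g : X.CoarseGroupoid =>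
      g.range ∈ Z.carrier ∧ g.source ∈ Z.carrier))
  simpa only [Set.preimage_ofPred_eq, CoarseGroupoid.entourage_mem_lift] using h

theorem continuous_ite {Y : Type*} [TopologicalSpace Y] {p : Y → Prop} [DecidablePred p]
    (hp : IsClopen {y | p y}) {f g : Y → ℂ} (hf : Continuous f) (hg : Continuous g) :
    Continuous fun y => if p y then f y else g y :=
  hf.if (fun a ha => by rw [hp.frontier_eq] at ha; exact ha.elim) hg

open Classical in
/-- The unit: the indicator function of the base space `Z ⊆ G(X)|_Z`. -/
instance : One (GroupoidAlgebra Z) :=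
  ⟨ofBounded (fun g => if g.1.range = g.1.source then 1 else 0) (by
      refine continuous_ite ?_ continuous_const continuous_const
      convert! isClopen_cl (Z := Z) 0 using 2
      ext g
      exact mem_cl_entourage_zero.symm) 0 (fun g hg => by
      refine mem_cl_entourage_zero.2 ?_
      by_contra h
      exact hg (if_neg h))⟩

/-- The inverse of a groupoid element. -/
def inv (g : Reduction Z) : Reduction Z :=
  ⟨⟨(g.1.source, g.1.range), by
    obtain ⟨R, hR⟩ := g.1.2
    exact ⟨R, cl_entourage_symm hR⟩⟩, g.2.2, g.2.1⟩

theorem continuous_inv : Continuous (inv (Z := Z)) := by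
  have h : Continuous fun g : X.CoarseGroupoid =>
      (⟨(g.source, g.range), by
        obtain ⟨R, hR⟩ := g.2
        exact ⟨R, cl_entourage_symm hR⟩⟩ : X.CoarseGroupoid) := by
    refine CoarseGroupoid.continuous_dom fun R => ?_
    refine CoarseGroupoid.continuous_of_bounded (R := R) ?_ fun p => cl_entourage_symm p.2
    exact continuous_swap.comp continuous_subtype_val
  exact (h.comp continuous_subtype_val).subtype_mk _

/-- The involution `f^*(g) = conj (f (g⁻¹))`. -/
instance : Star (GroupoidAlgebra Z) :=
  ⟨fun f => ⟨fun g => starRingEnd ℂ (f (inv g)),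
    Complex.continuous_conj.comp (f.continuous.comp continuous_inv), by
      obtain ⟨R, hR⟩ := hasCompactSupport_iff.1 f.hasCompactSupport
      refine hasCompactSupport_iff.2 ⟨R, fun g hg => cl_entourage_symm (hR (inv g) fun h => ?_)⟩
      exact hg (by rw [h, map_zero])⟩⟩

theorem ext0_ext {f g : GroupoidAlgebra Z} (h : ∀ ω η, ext0 f ω η = ext0 g ω η) : f = g :=
  ext fun x => by rw [← ext0_coe f, ← ext0_coe g, h]

theorem ext0_induction {f : GroupoidAlgebra Z} {ω η : X.Beta} {a : ℂ}
    (h : ∀ g : Reduction Z, g.1.1 = (ω, η) → f g = a)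
    (h0 : (¬ ∃ g : Reduction Z, g.1.1 = (ω, η)) → a = 0) : ext0 f ω η = a := by
  by_cases hg : ∃ g : Reduction Z, g.1.1 = (ω, η)
  · obtain ⟨g, hg⟩ := hg
    have := ext0_coe f g
    rw [hg] at this
    exact this.trans (h g hg)
  · rw [h0 hg]
    by_contra h1
    obtain ⟨g, hg', -⟩ := exists_of_ext0_ne h1
    exact hg ⟨g, hg'⟩

theorem ext0_of_not {f : GroupoidAlgebra Z} {ω η : X.Beta}
    (h : ¬ ∃ g : Reduction Z, g.1.1 = (ω, η)) : ext0 f ω η = 0 := by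
  by_contra h1
  obtain ⟨g, hg', -⟩ := exists_of_ext0_ne h1
  exact h ⟨g, hg'⟩

theorem ext0_add (f g : GroupoidAlgebra Z) (ω η : X.Beta) :
    ext0 (f + g) ω η = ext0 f ω η + ext0 g ω η := by
  unfold ext0
  split_ifs
  · rfl
  · simp

theorem ext0_smul (c : ℂ) (f : GroupoidAlgebra Z) (ω η : X.Beta) :
    ext0 (c • f) ω η = c * ext0 f ω η := by
  unfold ext0
  split_ifs
  · rfl
  · simp

theorem ext0_zero (ω η : X.Beta) : ext0 (0 : GroupoidAlgebra Z) ω η = 0 := by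
  unfold ext0
  split_ifs <;> rfl

open Classical in
theorem ext0_one (ω η : X.Beta) :
    ext0 (1 : GroupoidAlgebra Z) ω η = if ω = η ∧ ω ∈ Z.carrier then 1 else 0 := by
  refine ext0_induction (fun g hg => ?_) fun h => if_neg ?_
  · have h1 : g.1.range = ω := congrArg Prod.fst hg
    have h2 : g.1.source = η := congrArg Prod.snd hg
    have h3 := g.2.1
    change (if g.1.range = g.1.source then (1 : ℂ) else 0) = _
    rw [h1] at h3
    rw [h1, h2]
    simp [h3]
  · rintro ⟨rfl, h'⟩
    exact h ⟨⟨⟨(ω, ω), 0, mem_cl_entourage_zero.2 rfl⟩, h', h'⟩, rfl⟩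

theorem ext0_star (f : GroupoidAlgebra Z) (ω η : X.Beta) :
    ext0 (star f) ω η = starRingEnd ℂ (ext0 f η ω) := by
  refine ext0_induction (fun g hg => ?_) fun h => ?_
  · have h1 : g.1.range = ω := congrArg Prod.fst hg
    have h2 : g.1.source = η := congrArg Prod.snd hg
    rw [← h1, ← h2]
    exact congrArg (starRingEnd ℂ) (ext0_coe f (inv g)).symm
  · rw [ext0_of_not, map_zero]
    rintro ⟨g, hg⟩
    refine h ⟨inv g, ?_⟩
    have h1 : g.1.range = η := congrArg Prod.fst hg
    have h2 : g.1.source = ω := congrArg Prod.snd hg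
    rw [← h1, ← h2]; rfl

theorem ext0_mul (f g : GroupoidAlgebra Z) (ω η : X.Beta) :
    ext0 (f * g) ω η = ∑ᶠ ζ : X.Beta, ext0 f ω ζ * ext0 g ζ η := by
  refine ext0_induction (fun x hx => ?_) fun h => ?_
  · have h1 : x.1.range = ω := congrArg Prod.fst hx
    have h2 : x.1.source = η := congrArg Prod.snd hx
    rw [← h1, ← h2]; rfl
  · refine (finsum_congr fun ζ => ?_).trans finsum_zero
    by_contra h0
    obtain ⟨x, hx, -⟩ := exists_of_ext0_ne (left_ne_zero_of_mul h0)
    obtain ⟨y, hy, -⟩ := exists_of_ext0_ne (right_ne_zero_of_mul h0)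
    obtain ⟨R, hR⟩ := x.1.2
    obtain ⟨S, hS⟩ := y.1.2
    rw [hx] at hR
    rw [hy] at hS
    have h1 : x.1.range = ω := congrArg Prod.fst hx
    have h2 : y.1.source = η := congrArg Prod.snd hy
    exact h ⟨⟨⟨(ω, η), R + S, cl_entourage_comp hR hS⟩, h1 ▸ x.2.1, h2 ▸ y.2.2⟩, rfl⟩

theorem ext0_mul_row (f g : GroupoidAlgebra Z) (ω η : X.Beta) :
    ext0 (f * g) ω η = ∑ ζ ∈ (finite_row f ω).toFinset, ext0 f ω ζ * ext0 g ζ η := by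
  rw [ext0_mul]
  refine finsum_eq_sum_of_support_subset _ fun ζ hζ => ?_
  simpa using left_ne_zero_of_mul hζ

theorem ext0_mul_col (f g : GroupoidAlgebra Z) (ω η : X.Beta) :
    ext0 (f * g) ω η = ∑ ζ ∈ (finite_col g η).toFinset, ext0 f ω ζ * ext0 g ζ η := by
  rw [ext0_mul]
  refine finsum_eq_sum_of_support_subset _ fun ζ hζ => ?_
  simpa using right_ne_zero_of_mul hζ

theorem mem_of_ext0_ne {f : GroupoidAlgebra Z} {ω η : X.Beta} (h : ext0 f ω η ≠ 0) :
    ω ∈ Z.carrier ∧ η ∈ Z.carrier := by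
  unfold ext0 at h
  split_ifs at h with h'
  · exact h'.2
  · exact absurd rfl h

instance : Ring (GroupoidAlgebra Z) where
  __ := (inferInstance : AddCommGroup (GroupoidAlgebra Z))
  mul_assoc f g h := ext0_ext fun ω η => by
    rw [ext0_mul_col, ext0_mul_row]
    simp_rw [ext0_mul_row f g, ext0_mul_col g h, Finset.sum_mul, Finset.mul_sum, mul_assoc]
    exact Finset.sum_comm
  one_mul f := ext0_ext fun ω η => by
    classical
    rw [ext0_mul, finsum_eq_single _ ω]
    · rw [ext0_one]
      by_cases h : ext0 f ω η = 0
      · simp [h]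
      · simp [(mem_of_ext0_ne h).1]
    · intro ζ hζ
      rw [ext0_one, if_neg fun h => hζ h.1.symm, zero_mul]
  mul_one f := ext0_ext fun ω η => by
    classical
    rw [ext0_mul, finsum_eq_single _ η]
    · rw [ext0_one]
      by_cases h : ext0 f ω η = 0
      · simp [h]
      · simp [(mem_of_ext0_ne h).2]
    · intro ζ hζ
      rw [ext0_one, if_neg fun h => hζ h.1, mul_zero]
  left_distrib f g h := ext0_ext fun ω η => by
    rw [ext0_add, ext0_mul_row, ext0_mul_row, ext0_mul_row, ← Finset.sum_add_distrib]
    simp_rw [ext0_add, mul_add]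
  right_distrib f g h := ext0_ext fun ω η => by
    rw [ext0_add, ext0_mul_col, ext0_mul_col, ext0_mul_col, ← Finset.sum_add_distrib]
    simp_rw [ext0_add, add_mul]
  zero_mul f := ext0_ext fun ω η => by
    rw [ext0_mul_col]
    simp_rw [ext0_zero, zero_mul, Finset.sum_const_zero]
  mul_zero f := ext0_ext fun ω η => by
    rw [ext0_mul_row]
    simp_rw [ext0_zero, mul_zero, Finset.sum_const_zero]

instance : Algebra ℂ (GroupoidAlgebra Z) :=
  Algebra.ofModule
    (fun c f g => ext0_ext fun ω η => by
      rw [ext0_smul, ext0_mul_col, ext0_mul_col, Finset.mul_sum]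
      simp_rw [ext0_smul, mul_assoc])
    (fun c f g => ext0_ext fun ω η => by
      rw [ext0_smul, ext0_mul_row, ext0_mul_row, Finset.mul_sum]
      simp_rw [ext0_smul, mul_left_comm])

instance : StarRing (GroupoidAlgebra Z) where
  star_involutive f := ext0_ext fun ω η => by
    rw [ext0_star, ext0_star, Complex.conj_conj]
  star_mul f g := ext0_ext fun ω η => by
    rw [ext0_star, ext0_mul_col, ext0_mul_row, map_sum]
    have h : (finite_row (star g) ω).toFinset = (finite_col g ω).toFinset := by
      ext ζ
      simp [ext0_star]
    rw [h]
    simp_rw [ext0_star, map_mul, mul_comm]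
  star_add f g := ext0_ext fun ω η => by
    rw [ext0_star, ext0_add, ext0_add, ext0_star, ext0_star, map_add]

instance : StarModule ℂ (GroupoidAlgebra Z) where
  star_smul c f := ext0_ext fun ω η => by
    rw [ext0_star, ext0_smul, ext0_smul, ext0_star, map_mul]; rfl

end GroupoidAlgebra

variable (X) in
/-- The Stone-Čech boundary `∂βX = βX \ X`. -/
def boundary : X.InvariantSet where
  carrier := (Set.range (pure : X.Pt → X.Beta))ᶜ
  isClosed := by
    rw [isClosed_compl_iff, ← Set.iUnion_singleton_eq_range]
    refine isOpen_iUnion fun x => ?_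
    convert! ultrafilter_isOpen_basic ({x} : Set X.Pt)
    ext ω
    exact ⟨fun h => by rw [Set.mem_singleton_iff.1 h]; exact Set.mem_singleton x, fun h =>
      Ultrafilter.eq_of_le (by simpa using h)⟩
  invariant := by
    have key : ∀ {R : ℕ} {ω η : X.Beta}, (ω, η) ∈ X.cl (X.entourage R) →
        ω ∈ Set.range (pure : X.Pt → X.Beta) → η ∈ Set.range (pure : X.Pt → X.Beta) := by
      rintro R _ η h ⟨x, rfl⟩
      obtain ⟨t, rfl, -⟩ := mem_cl_entourage_iff.1 h
      exact ⟨t x, (Ultrafilter.map_pure t x).symm⟩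
    intro g
    obtain ⟨R, hR⟩ := g.exists_mem
    exact not_congr ⟨fun h => key (cl_entourage_symm hR) h, fun h => key hR h⟩

namespace GroupoidAlgebra

variable {Z : X.InvariantSet}

/-- The element of `C_c(G(X)|_Z)` defined by a matrix `(T_{xy})` of finite propagation with
bounded entries: the continuous extension of `(x, y) ↦ T_{xy}` to `G(X)`, restricted to
`G(X)|_Z`. -/
def ofMatrix (T : X.Pt → X.Pt → ℂ) (hC : ∃ C : ℝ, ∀ x y, ‖T x y‖ ≤ C)
    (hR : ∃ R : ℕ, ∀ x y, T x y ≠ 0 → X.G.edist x y ≤ R) : GroupoidAlgebra Z where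
  toFun g := limUnder (g.1.lift : Filter (X.Pt × X.Pt)) fun p => T p.1 p.2
  continuous := by
    obtain ⟨C, hC⟩ := hC
    let T' : X.Pt × X.Pt → Metric.closedBall (0 : ℂ) C := fun p =>
      ⟨T p.1 p.2, by simpa using hC p.1 p.2⟩
    have : CompactSpace (Metric.closedBall (0 : ℂ) C) :=
      isCompact_iff_compactSpace.1 (isCompact_closedBall _ _)
    have h : ∀ Ω : Ultrafilter (X.Pt × X.Pt), limUnder (Ω : Filter (X.Pt × X.Pt))
        (fun p => T p.1 p.2) = (Ultrafilter.extend T' Ω).1 := by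
      intro Ω
      have h1 : Tendsto T' Ω (𝓝 (Ultrafilter.extend T' Ω)) := ultrafilter_extend_eq_iff.1 rfl
      exact ((continuous_subtype_val.tendsto _).comp h1).limUnder_eq
    simp_rw [h]
    exact continuous_subtype_val.comp ((continuous_ultrafilter_extend T').comp
      (CoarseGroupoid.continuous_lift.comp continuous_subtype_val))
  hasCompactSupport := by
    obtain ⟨R, hR⟩ := hR
    refine hasCompactSupport_iff.2 ⟨R, fun g hg => ?_⟩
    refine CoarseGroupoid.entourage_mem_lift.1 ?_
    by_contra h
    refine hg (Tendsto.limUnder_eq (tendsto_const_nhds.congr' ?_))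
    filter_upwards [Ultrafilter.compl_mem_iff_notMem.2 h] with p hp
    by_contra h0
    exact hp (hR _ _ (Ne.symm h0))

/-- The value of the extension at a pair of points of `X` is the matrix entry. -/
theorem ofMatrix_pure {T : X.Pt → X.Pt → ℂ} {hC hR} {g : Reduction Z} {x y : X.Pt}
    (hg : g.1.val = (pure x, pure y)) : (ofMatrix T hC hR : GroupoidAlgebra Z) g = T x y := by
  have h : g.1.lift = pure (x, y) := by
    obtain ⟨R, h⟩ := g.1.exists_mem
    rw [hg] at h
    obtain ⟨t, h1, h2⟩ := mem_cl_entourage_iff.1 h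
    rw [Ultrafilter.map_pure] at h1
    obtain rfl := Ultrafilter.pure_injective h1
    exact g.1.lift_eq (R := R) (show X.entourage R ∈ (pure (x, t x) : Ultrafilter _) from h2)
      (by rw [hg, Ultrafilter.map_pure, Ultrafilter.map_pure])
  change limUnder (g.1.lift : Filter (X.Pt × X.Pt)) _ = _
  rw [h]
  exact (tendsto_pure_nhds (fun p : X.Pt × X.Pt => T p.1 p.2) (x, y)).limUnder_eq

instance : BoundedReps (GroupoidAlgebra Z) := BoundedReps.of_sum fun f => by
  classical
  obtain ⟨R, hR⟩ := f.exists_support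
  obtain ⟨N, c, -, -, hc⟩ := X.exists_translations R
  have hclopen : ∀ k, IsClopen {g : Reduction Z | {x | c x = k} ∈ g.1.source} := fun k =>
    IsClopen.preimage ⟨ultrafilter_isClosed_basic _, ultrafilter_isOpen_basic _⟩
      (continuous_snd.comp (CoarseGroupoid.continuous_val.comp continuous_subtype_val))
  let b : Fin N → GroupoidAlgebra Z := fun k =>
    ofBounded (fun g => if {x | c x = k} ∈ g.1.source then f g else 0)
      (continuous_ite (hclopen k) f.continuous continuous_const) R fun g hg => by
        refine hR _ _ ?_
        rw [ext0_coe]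
        intro h0
        exact hg (by simp [h0])
  have hb : ∀ k ω η, ext0 (b k) ω η ≠ 0 →
      (ω, η) ∈ X.cl (X.entourage R) ∧ {x | c x = k} ∈ η := by
    intro k ω η h
    obtain ⟨g, hg, hne⟩ := exists_of_ext0_ne h
    have h1 : g.1.range = ω := congrArg Prod.fst hg
    have h2 : g.1.source = η := congrArg Prod.snd hg
    have h3 : (if {x | c x = k} ∈ g.1.source then f g else 0) ≠ 0 := hne
    rw [ne_eq, ite_eq_right_iff, Classical.not_imp] at h3
    refine ⟨?_, h2 ▸ h3.1⟩
    rw [← h1, ← h2]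
    refine hR _ _ ?_
    have := ext0_coe f g
    exact fun h => h3.2 (this.symm.trans h)
  -- `b_k^* b_k` is supported on the diagonal
  have hdiag : ∀ k ω η, ext0 (star (b k) * b k) ω η ≠ 0 → ω = η := by
    intro k ω η h
    rw [ext0_mul_col] at h
    obtain ⟨ζ, -, hζ⟩ := Finset.exists_ne_zero_of_sum_ne_zero h
    rw [ext0_star] at hζ
    obtain ⟨h1, h1'⟩ := hb k ζ ω fun h0 => hζ (by rw [h0, map_zero, zero_mul])
    obtain ⟨h2, h2'⟩ := hb k ζ η (right_ne_zero_of_mul hζ)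
    obtain ⟨Ω, hΩ, h3⟩ := mem_cl_iff.1 (cl_entourage_comp (cl_entourage_symm h1) h2)
    obtain ⟨rfl, rfl⟩ := Prod.mk.inj h3
    refine Ultrafilter.coe_injective ?_
    rw [Ultrafilter.coe_map, Ultrafilter.coe_map]
    refine Filter.map_congr ?_
    filter_upwards [hΩ, show ∀ᶠ p in (Ω : Filter (X.Pt × X.Pt)), c p.1 = k from h1',
      show ∀ᶠ p in (Ω : Filter (X.Pt × X.Pt)), c p.2 = k from h2'] with p hp hp1 hp2
    exact hc _ _ hp (hp1.trans hp2.symm)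
  have hreal : ∀ k ω, ∃ r : ℝ, 0 ≤ r ∧ ext0 (star (b k) * b k) ω ω = r := by
    intro k ω
    rw [ext0_mul_col]
    refine ⟨∑ ζ ∈ (finite_col (b k) ω).toFinset, ‖ext0 (b k) ζ ω‖ ^ 2,
      Finset.sum_nonneg fun _ _ => sq_nonneg _, ?_⟩
    push_cast
    refine Finset.sum_congr rfl fun ζ _ => ?_
    rw [ext0_star, mul_comm, Complex.mul_conj, Complex.normSq_eq_norm_sq]
    push_cast; rfl
  choose M hM using fun k => (star (b k) * b k).hasCompactSupport.exists_bound_of_continuous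
    (star (b k) * b k).continuous
  have hM' : ∀ k ω η, ‖ext0 (star (b k) * b k) ω η‖ ≤ max (M k) 0 := by
    intro k ω η
    by_cases h : ext0 (star (b k) * b k) ω η = 0
    · rw [h, norm_zero]; exact le_max_right _ _
    · obtain ⟨g, hg, -⟩ := exists_of_ext0_ne h
      have := ext0_coe (star (b k) * b k) g
      rw [hg] at this
      exact this ▸ (hM k g).trans (le_max_left _ _)
  let g : Fin N → GroupoidAlgebra Z := fun k =>
    ofBounded (fun x => if x.1.range = x.1.source then
        ((√(max (M k) 0 - ((star (b k) * b k : GroupoidAlgebra Z) x).re) : ℝ) : ℂ) else 0)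
      (continuous_ite (by
          convert! isClopen_cl (Z := Z) 0 using 2
          ext x
          exact mem_cl_entourage_zero.symm)
        (Complex.continuous_ofReal.comp (Real.continuous_sqrt.comp (continuous_const.sub
          (Complex.continuous_re.comp (star (b k) * b k).continuous)))) continuous_const)
      0 fun x hx => mem_cl_entourage_zero.2 (by
        by_contra h
        exact hx (if_neg h))
  have hg : ∀ k ω η, ext0 (g k) ω η = if ω = η ∧ ω ∈ Z.carrier then
      ((√(max (M k) 0 - (ext0 (star (b k) * b k) ω η).re) : ℝ) : ℂ) else 0 := by
    intro k ω η
    refine ext0_induction (fun x hx => ?_) fun h => if_neg ?_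
    · have h1 : x.1.range = ω := congrArg Prod.fst hx
      have h2 : x.1.source = η := congrArg Prod.snd hx
      have h3 := x.2.1
      have h4 := ext0_coe (star (b k) * b k) x
      rw [hx] at h4
      change (if x.1.range = x.1.source then
        ((√(max (M k) 0 - ((star (b k) * b k : GroupoidAlgebra Z) x).re) : ℝ) : ℂ) else 0) = _
      rw [h1] at h3
      rw [h1, h2, h4]
      simp [h3]
    · rintro ⟨rfl, h'⟩
      exact h ⟨⟨⟨(ω, ω), 0, mem_cl_entourage_zero.2 rfl⟩, h', h'⟩, rfl⟩
  refine ⟨N, b, g, fun k => max (M k) 0, ?_, fun k => ?_⟩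
  · refine ext fun x => ?_
    have hsum : (∑ k, b k : GroupoidAlgebra Z) x = ∑ k, b k x :=
      map_sum (⟨⟨fun f : GroupoidAlgebra Z => f x, rfl⟩, fun _ _ => rfl⟩ :
        GroupoidAlgebra Z →+ ℂ) b Finset.univ
    rw [hsum]
    obtain ⟨k, hk⟩ := exists_colour c x.1.source
    rw [Finset.sum_eq_single k]
    · exact (if_pos hk).symm
    · intro l _ hl
      refine if_neg fun h => hl ?_
      obtain ⟨y, hy1, hy2⟩ := Ultrafilter.nonempty_of_mem (Filter.inter_mem h hk)
      exact hy1.symm.trans hy2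
    · exact fun h => absurd (Finset.mem_univ k) h
  · refine ext0_ext fun ω η => ?_
    rw [ext0_add, ext0_smul, ext0_one, ext0_mul (star (g k)), finsum_eq_single _ ω]
    · by_cases h : ω = η ∧ ω ∈ Z.carrier
      · obtain ⟨rfl, hω⟩ := h
        obtain ⟨r, hr, hr'⟩ := hreal k ω
        have h1 := hM' k ω ω
        rw [hr', Complex.norm_real, Real.norm_of_nonneg hr] at h1
        rw [ext0_star, hg, if_pos ⟨rfl, hω⟩, if_pos ⟨rfl, hω⟩, Complex.conj_ofReal, hr',
          Complex.ofReal_re, ← Complex.ofReal_mul, Real.mul_self_sqrt (by linarith)]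
        push_cast
        ring
      · rw [hg, if_neg h, if_neg h, mul_zero, mul_zero, add_zero]
        by_contra h0
        exact h ⟨hdiag k ω η h0, (mem_of_ext0_ne h0).1⟩
    · intro ζ hζ
      rw [ext0_star, hg, if_neg fun h => hζ h.1, map_zero, zero_mul]

end GroupoidAlgebra

/-! ### The algebraic Roe algebra -/

variable (X) in
/-- The Hilbert space `ℓ²(X)`. -/
abbrev L2 : Type u := lp (fun _ : X.Pt => ℂ) 2

/-- The standard basis vector `δ_x ∈ ℓ²(X)`. -/
def delta (x : X.Pt) : X.L2 := open Classical in lp.single 2 x 1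

theorem inner_delta_left (x : X.Pt) (f : X.L2) : inner ℂ (delta x) f = f x := by
  classical
  rw [delta, lp.inner_single_left]
  simp

open Classical in
theorem delta_apply (x y : X.Pt) : (delta x : X.L2) y = if y = x then 1 else 0 := by
  rw [delta, lp.single_apply]
  split_ifs with h
  · subst h; simp
  · simp [h]

theorem op_ext {T S : X.L2 →L[ℂ] X.L2} (h : ∀ x, T (delta x) = S (delta x)) : T = S := by
  classical
  refine lp.ext_continuousLinearMap (by simp) fun x => ?_
  ext1
  simpa [delta] using h x

variable (X) in
/-- The algebraic Roe algebra `ℂ[X]`: the bounded operators on `ℓ²(X)` of finite propagation. -/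
def roeAlgebra : StarSubalgebra ℂ (X.L2 →L[ℂ] X.L2) where
  carrier := {T | ∃ R : ℕ, ∀ x y, R ≤ X.G.edist x y → inner ℂ (T (delta x)) (delta y) = 0}
  mul_mem' := by
    rintro T S ⟨R, hT⟩ ⟨R', hS⟩
    refine ⟨R + R', fun x y h => ?_⟩
    rw [mul_apply_eq_comp, ← ContinuousLinearMap.adjoint_inner_right, lp.inner_eq_tsum]
    refine (tsum_congr fun z => ?_).trans tsum_zero
    rw [← inner_delta_left z (S (delta x)), ← inner_delta_left z,
      ContinuousLinearMap.adjoint_inner_right]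
    by_cases h1 : R' ≤ X.G.edist x z
    · rw [← inner_conj_symm (delta z) (S (delta x)), hS x z h1, map_zero, inner_zero_left]
    · have h2 : R ≤ X.G.edist z y := by
        by_contra h2
        refine absurd h (not_le.2 ?_)
        refine (SimpleGraph.edist_triangle (v := z)).trans_lt ?_
        rw [Nat.cast_add, add_comm (R : ℕ∞)]
        exact ENat.add_lt_add (not_le.1 h1) (not_le.1 h2)
      rw [hT z y h2, inner_zero_right]
  add_mem' := by
    rintro T S ⟨R, hT⟩ ⟨R', hS⟩
    refine ⟨max R R', fun x y h => ?_⟩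
    rw [add_apply, inner_add_left, hT x y (le_trans (by simp) h),
      hS x y (le_trans (by simp) h), add_zero]
  algebraMap_mem' := by
    intro c
    refine ⟨1, fun x y h => ?_⟩
    have hne : y ≠ x := by
      rintro rfl
      simp at h
    rw [Algebra.algebraMap_eq_smul_one, smul_apply, one_apply_eq_self, inner_smul_left,
      inner_delta_left, delta_apply, if_neg hne.symm, mul_zero]
  star_mem' := by
    rintro T ⟨R, hT⟩
    refine ⟨R, fun x y h => ?_⟩
    rw [ContinuousLinearMap.star_eq_adjoint, ContinuousLinearMap.adjoint_inner_left,
      ← inner_conj_symm, hT y x (by rwa [SimpleGraph.edist_comm]), map_zero]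

/-- The operator on `ℓ²(X)` given by a linear map on functions that is bounded in `ℓ²`-norm. -/
def opOfBound (L : (X.Pt → ℂ) →ₗ[ℂ] (X.Pt → ℂ)) (C : ℝ) (hC : 0 ≤ C)
    (h : ∀ (f : X.L2) (s : Finset X.Pt), ∑ x ∈ s, ‖L f x‖ ^ 2 ≤ (C * ‖f‖) ^ 2) :
    X.L2 →L[ℂ] X.L2 :=
  LinearMap.mkContinuous
    { toFun := fun f => ⟨L f, memℓp_gen' (C := (C * ‖f‖) ^ 2) fun s => by simpa using h f s⟩
      map_add' := fun f g => Subtype.ext (map_add L (f : X.Pt → ℂ) g)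
      map_smul' := fun c f => Subtype.ext (map_smul L c (f : X.Pt → ℂ)) } C
    fun f => lp.norm_le_of_forall_sum_le (by simp) (mul_nonneg hC (norm_nonneg f))
      fun s => by simpa using h f s

theorem opOfBound_apply (L : (X.Pt → ℂ) →ₗ[ℂ] (X.Pt → ℂ)) (C : ℝ) (hC : 0 ≤ C) (h) (f : X.L2)
    (x : X.Pt) : opOfBound L C hC h f x = L f x := rfl

theorem sum_sq_le (f : X.L2) (s : Finset X.Pt) : ∑ x ∈ s, ‖f x‖ ^ 2 ≤ ‖f‖ ^ 2 := by
  simpa using lp.sum_rpow_le_norm_rpow (p := 2) (by simp) f s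

/-- Multiplication by a bounded function, as an operator on `ℓ²(X)`. -/
def diagOp (a : X.Pt → ℂ) (C : ℝ) (hC0 : 0 ≤ C) (hC : ∀ x, ‖a x‖ ≤ C) : X.L2 →L[ℂ] X.L2 :=
  opOfBound (LinearMap.mulLeft ℂ a) C hC0 fun f s => by
    rw [mul_pow]
    refine le_trans ?_ (mul_le_mul_of_nonneg_left (sum_sq_le f s) (sq_nonneg C))
    rw [Finset.mul_sum]
    refine Finset.sum_le_sum fun x _ => ?_
    rw [LinearMap.mulLeft_apply, Pi.mul_apply, norm_mul, mul_pow]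
    gcongr
    exact hC x

theorem diagOp_delta {a : X.Pt → ℂ} {C : ℝ} {hC0 hC} (x : X.Pt) :
    diagOp a C hC0 hC (delta x) = a x • delta x := by
  classical
  ext y
  change a y * (delta x : X.L2) y = a x * (delta x : X.L2) y
  rw [delta_apply]
  split_ifs with h
  · rw [h]
  · simp

theorem diagOp_mem {a : X.Pt → ℂ} {C : ℝ} {hC0 hC} : diagOp a C hC0 hC ∈ X.roeAlgebra := by
  refine ⟨1, fun x y h => ?_⟩
  have hne : x ≠ y := by
    rintro rfl
    simp at h
  classical
  rw [diagOp_delta, inner_smul_left, inner_delta_left, delta_apply, if_neg hne, mul_zero]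

variable (X) in
/-- The graph Laplacian on functions: `(Δ f)(x) = ∑_{y ∼ x} (f(x) - f(y))`. -/
def laplacianFun : (X.Pt → ℂ) →ₗ[ℂ] (X.Pt → ℂ) where
  toFun f x := ∑ y ∈ X.G.neighborFinset x, (f x - f y)
  map_add' f g := by
    funext x
    simp only [Pi.add_apply, ← Finset.sum_add_distrib]
    exact Finset.sum_congr rfl fun _ _ => by ring
  map_smul' c f := by
    funext x
    simp only [Pi.smul_apply, smul_eq_mul, RingHom.id_apply, Finset.mul_sum, mul_sub]

theorem laplacianFun_bound {d : ℕ} (hd : ∀ x, X.G.degree x ≤ d) (f : X.L2) (s : Finset X.Pt) :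
    ∑ x ∈ s, ‖X.laplacianFun f x‖ ^ 2 ≤ (2 * d * ‖f‖) ^ 2 := by
  classical
  have h1 : ∀ x, ‖X.laplacianFun f x‖ ^ 2 ≤
      2 * d * (d * ‖f x‖ ^ 2 + ∑ y ∈ X.G.neighborFinset x, ‖f y‖ ^ 2) := by
    intro x
    have hdx : ((X.G.neighborFinset x).card : ℝ) ≤ d := by exact_mod_cast hd x
    calc ‖X.laplacianFun f x‖ ^ 2
        ≤ (∑ y ∈ X.G.neighborFinset x, ‖f x - f y‖) ^ 2 := by
          gcongr
          exact norm_sum_le _ _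
      _ ≤ (X.G.neighborFinset x).card * ∑ y ∈ X.G.neighborFinset x, ‖f x - f y‖ ^ 2 :=
          sq_sum_le_card_mul_sum_sq
      _ ≤ d * ∑ y ∈ X.G.neighborFinset x, (2 * ‖f x‖ ^ 2 + 2 * ‖f y‖ ^ 2) := by
          gcongr with y _
          have h := norm_sub_le (f x) (f y)
          have h0 := norm_nonneg (f x - f y)
          nlinarith [sq_nonneg (‖f x‖ - ‖f y‖)]
      _ = d * (2 * ((X.G.neighborFinset x).card * ‖f x‖ ^ 2) +
            2 * ∑ y ∈ X.G.neighborFinset x, ‖f y‖ ^ 2) := by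
          rw [Finset.sum_add_distrib, Finset.sum_const, nsmul_eq_mul, Finset.mul_sum]
          ring
      _ ≤ d * (2 * (d * ‖f x‖ ^ 2) + 2 * ∑ y ∈ X.G.neighborFinset x, ‖f y‖ ^ 2) := by gcongr
      _ = _ := by ring
  have h2 : ∑ x ∈ s, ∑ y ∈ X.G.neighborFinset x, ‖f y‖ ^ 2 ≤ d * ‖f‖ ^ 2 := by
    calc ∑ x ∈ s, ∑ y ∈ X.G.neighborFinset x, ‖f y‖ ^ 2
        = ∑ y ∈ s.biUnion (X.G.neighborFinset ·), ∑ x ∈ s.filter (X.G.Adj y), ‖f y‖ ^ 2 := by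
          refine Finset.sum_comm' fun x y => ?_
          simp only [SimpleGraph.mem_neighborFinset, Finset.mem_filter, Finset.mem_biUnion]
          exact ⟨fun h => ⟨⟨h.1, h.2.symm⟩, x, h.1, h.2⟩, fun h => ⟨h.1.1, h.1.2.symm⟩⟩
      _ ≤ ∑ y ∈ s.biUnion (X.G.neighborFinset ·), d * ‖f y‖ ^ 2 := by
          refine Finset.sum_le_sum fun y _ => ?_
          rw [Finset.sum_const, nsmul_eq_mul]
          gcongr
          refine le_trans (Finset.card_le_card fun x hx => ?_) (hd y)
          simpa using (Finset.mem_filter.1 hx).2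
      _ ≤ d * ‖f‖ ^ 2 := by
          rw [← Finset.mul_sum]
          gcongr
          exact sum_sq_le f _
  calc ∑ x ∈ s, ‖X.laplacianFun f x‖ ^ 2
      ≤ ∑ x ∈ s, 2 * d * (d * ‖f x‖ ^ 2 + ∑ y ∈ X.G.neighborFinset x, ‖f y‖ ^ 2) :=
        Finset.sum_le_sum fun x _ => h1 x
    _ = 2 * d * (d * ∑ x ∈ s, ‖f x‖ ^ 2 + ∑ x ∈ s, ∑ y ∈ X.G.neighborFinset x, ‖f y‖ ^ 2) := by
        rw [← Finset.mul_sum, Finset.sum_add_distrib, Finset.mul_sum]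
    _ ≤ 2 * d * (d * ‖f‖ ^ 2 + d * ‖f‖ ^ 2) := by
        gcongr
        exact sum_sq_le f s
    _ = _ := by ring

variable (X) in
/-- The Laplace operator as a bounded operator on `ℓ²(X)`. -/
def laplacianOp : X.L2 →L[ℂ] X.L2 :=
  opOfBound X.laplacianFun (2 * X.exists_degree_le.choose) (by positivity)
    (laplacianFun_bound X.exists_degree_le.choose_spec)

theorem laplacianOp_apply (f : X.L2) (x : X.Pt) :
    X.laplacianOp f x = ∑ y ∈ X.G.neighborFinset x, (f x - f y) := rfl

open Classical in
/-- The matrix entries of the Laplace operator. -/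
theorem inner_laplacianOp (x y : X.Pt) : inner ℂ (delta x) (X.laplacianOp (delta y)) =
    if x = y then (X.G.degree x : ℂ) else if X.G.Adj x y then -1 else 0 := by
  rw [inner_delta_left, laplacianOp_apply]
  simp only [delta_apply]
  split_ifs with h1 h2
  · subst h1
    rw [Finset.sum_congr rfl (g := fun _ => (1 : ℂ))]
    · simp
    · intro z hz
      rw [SimpleGraph.mem_neighborFinset] at hz
      simp [hz.ne']
  · rw [Finset.sum_eq_single y]
    · simp
    · intro z _ hz
      simp [hz]
    · intro h
      exact absurd (by simpa using h2) h
  · refine Finset.sum_eq_zero fun z hz => ?_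
    have : z ≠ y := by
      rintro rfl
      exact h2 (by simpa using hz)
    simp [this]

variable (X) in
/-- The Laplace operator as an element of the algebraic Roe algebra. -/
def laplacian : X.roeAlgebra := ⟨X.laplacianOp, by
  classical
  refine ⟨2, fun x y h => ?_⟩
  rw [← inner_conj_symm, inner_laplacianOp]
  have h1 : ¬ X.G.edist x y ≤ 1 := fun h1 => absurd (h.trans h1) (by decide)
  rw [SimpleGraph.edist_le_one_iff_adj_or_eq, not_or] at h1
  rw [if_neg (Ne.symm h1.2), if_neg fun h => h1.1 h.symm, map_zero]⟩

instance : BoundedReps X.roeAlgebra := BoundedReps.of_sum fun a => by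
  classical
  obtain ⟨R, hR⟩ := a.2
  obtain ⟨N, c, -, -, hc⟩ := X.exists_translations R
  let p : Fin N → X.roeAlgebra := fun k =>
    ⟨diagOp (fun x => if c x = k then 1 else 0) 1 zero_le_one
      (fun x => by split_ifs <;> simp), diagOp_mem⟩
  have hp : ∀ k x, (p k : X.L2 →L[ℂ] X.L2) (delta x) =
      (if c x = k then 1 else 0 : ℂ) • delta x := fun k x => by
    simp only [p]
    exact diagOp_delta x
  let b : Fin N → X.roeAlgebra := fun k => a * p k
  have hb : ∀ k x, (b k : X.L2 →L[ℂ] X.L2) (delta x) =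
      if c x = k then (a : X.L2 →L[ℂ] X.L2) (delta x) else 0 := by
    intro k x
    change (a : X.L2 →L[ℂ] X.L2) ((p k : X.L2 →L[ℂ] X.L2) (delta x)) = _
    rw [hp]
    split_ifs <;> simp
  let B : Fin N → ℝ := fun k => ‖(b k : X.L2 →L[ℂ] X.L2)‖
  let h : Fin N → X.Pt → ℝ := fun k x => ‖(b k : X.L2 →L[ℂ] X.L2) (delta x)‖ ^ 2
  have hh : ∀ k x, 0 ≤ B k ^ 2 - h k x := by
    intro k x
    have h1 := (b k : X.L2 →L[ℂ] X.L2).le_opNorm (delta x)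
    have h2 : ‖(delta x : X.L2)‖ = 1 := by
      rw [delta, lp.norm_single (by simp)]
      simp
    rw [h2, mul_one] at h1
    exact sub_nonneg.2 (pow_le_pow_left₀ (norm_nonneg _) h1 2)
  let g : Fin N → X.roeAlgebra := fun k =>
    ⟨diagOp (fun x => (√(B k ^ 2 - h k x) : ℝ)) (B k) (norm_nonneg _) (fun x => by
      rw [Complex.norm_real, Real.norm_of_nonneg (Real.sqrt_nonneg _)]
      refine (Real.sqrt_le_sqrt (sub_le_self _ (sq_nonneg _))).trans ?_
      rw [Real.sqrt_sq (norm_nonneg _)]), diagOp_mem⟩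
  refine ⟨N, b, g, fun k => B k ^ 2, ?_, fun k => ?_⟩
  · rw [← Finset.mul_sum]
    have : ∑ k, p k = 1 := by
      refine Subtype.ext (op_ext fun x => ?_)
      rw [AddSubmonoidClass.coe_finsetSum, sum_apply, Finset.sum_eq_single (c x)]
      · rw [hp, if_pos rfl, one_smul]; rfl
      · intro l _ hl
        rw [hp, if_neg hl.symm, zero_smul]
      · exact fun h => absurd (Finset.mem_univ _) h
    rw [this, mul_one]
  · refine Subtype.ext (op_ext fun x => ?_)
    ext y
    rw [← inner_delta_left y, ← inner_delta_left y]
    change inner ℂ (delta y) (ContinuousLinearMap.adjoint (b k : X.L2 →L[ℂ] X.L2)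
      ((b k : X.L2 →L[ℂ] X.L2) (delta x)) + ContinuousLinearMap.adjoint (g k : X.L2 →L[ℂ] X.L2)
      ((g k : X.L2 →L[ℂ] X.L2) (delta x))) = inner ℂ (delta y) (((B k ^ 2 : ℝ) : ℂ) • delta x)
    have hg : ∀ x, (g k : X.L2 →L[ℂ] X.L2) (delta x) =
        ((√(B k ^ 2 - h k x) : ℝ) : ℂ) • delta x := fun x => by
      simp only [g]
      exact diagOp_delta x
    rw [inner_add_right, ContinuousLinearMap.adjoint_inner_right,
      ContinuousLinearMap.adjoint_inner_right, hg, hg, inner_smul_right, inner_smul_left,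
      inner_smul_right, inner_delta_left, delta_apply]
    by_cases hxy : y = x
    · subst hxy
      rw [inner_self_eq_norm_sq_to_K, if_pos rfl, mul_one, mul_one, Complex.conj_ofReal,
        ← Complex.ofReal_mul, Real.mul_self_sqrt (hh k y)]
      change (‖(b k : X.L2 →L[ℂ] X.L2) (delta y)‖ : ℂ) ^ 2 + _ = _
      simp only [h]
      push_cast
      ring
    · rw [if_neg hxy, mul_zero, mul_zero, mul_zero, add_zero, hb, hb]
      split_ifs with h1 h2
      · rw [lp.inner_eq_tsum]
        refine (tsum_congr fun z => ?_).trans tsum_zero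
        rw [← inner_delta_left z, ← inner_delta_left z]
        by_cases h3 : R ≤ X.G.edist x z
        · rw [← inner_conj_symm (delta z) ((a : X.L2 →L[ℂ] X.L2) (delta x)), hR x z h3, map_zero,
            inner_zero_right]
        · by_cases h4 : R ≤ X.G.edist y z
          · rw [← inner_conj_symm (delta z) ((a : X.L2 →L[ℂ] X.L2) (delta y)), hR y z h4,
              map_zero, inner_zero_left]
          · refine absurd (hc y x ?_ (h1.trans h2.symm)) hxy
            refine (SimpleGraph.edist_triangle (v := z)).trans ?_
            rw [Nat.cast_add, SimpleGraph.edist_comm (u := z)]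
            exact add_le_add (not_le.1 h4).le (not_le.1 h3).le
      all_goals simp

/-! ### The restriction to the boundary and spectral gaps -/

/-- The image of an operator `T ∈ ℂ[X]` with matrix entries `T_{xy} = ⟨δ_x, T δ_y⟩` in
`C_c(G(X)|_Z)`: under the identification `ℂ[X] ≅ C_c(G(X))` the operator `T` corresponds to the
continuous extension of its matrix to `G(X)`, and this is then restricted to `Z`. -/
def restrict (Z : X.InvariantSet) (T : X.roeAlgebra) : GroupoidAlgebra Z :=
  GroupoidAlgebra.ofMatrix (fun x y => inner ℂ (delta x) ((T : X.L2 →L[ℂ] X.L2) (delta y)))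
    ⟨‖(T : X.L2 →L[ℂ] X.L2)‖, fun x y => by
      have h2 : ∀ x, ‖(delta x : X.L2)‖ = 1 := fun x => by
        classical
        rw [delta, lp.norm_single (by simp)]
        simp
      refine (norm_inner_le_norm _ _).trans ?_
      rw [h2, one_mul]
      refine ((T : X.L2 →L[ℂ] X.L2).le_opNorm _).trans ?_
      rw [h2, mul_one]⟩
    (by
      obtain ⟨R, hR⟩ := T.2
      refine ⟨R, fun x y h => ?_⟩
      by_contra h1
      refine h ?_
      rw [← inner_conj_symm, hR y x (by rw [SimpleGraph.edist_comm]; exact (not_le.1 h1).le),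
        map_zero])

/-- `a` has spectral gap of size `c`: the spectrum of `a` is contained in `{0} ∪ [c, ∞)`. -/
def HasSpectralGap {A : Type*} [Ring A] [Algebra ℂ A] (a : A) (c : ℝ) : Prop :=
  spectrum ℂ a ⊆ {0} ∪ Complex.ofReal '' Set.Ici c

variable (X)

/-- The Laplace operator in `B(ℓ²(X))` has spectral gap of size `c`. -/
def ExpanderGap (c : ℝ) : Prop := HasSpectralGap X.laplacianOp c

/-- The Laplace operator in the maximal uniform Roe algebra `C*_{u,max}(X)`, the maximal
C*-algebra of `ℂ[X]`, has spectral gap of size `c`. -/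
def GeometricGap (c : ℝ) : Prop := HasSpectralGap (toMaxCStar X.laplacian) c

/-- The Laplace operator in the maximal C*-algebra `C*_max(∂G(X))` of the boundary groupoid
`∂G(X) = G(X)|_{∂βX}` has spectral gap of size `c`. -/
def BoundaryGap (c : ℝ) : Prop := HasSpectralGap (toMaxCStar (restrict X.boundary X.laplacian)) c

/-- `X` is an expander. -/
def IsExpander : Prop := ∃ c > 0, X.ExpanderGap c

/-- `X` has geometric property (T). -/
def GeometricPropertyT : Prop := ∃ c > 0, X.GeometricGap c

/-- `X` has boundary geometric property (T). -/
def BoundaryPropertyT : Prop := ∃ c > 0, X.BoundaryGap c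

end BoxSpace

end

/-!
For a self-adjoint element `a` of a C*-algebra and `c > 0`, the spectrum of `a` lies in
`{0} ∪ [c, ∞)` if and only if `a (a - c) a` is positive, because `t (t - c) t` is nonnegative exactly
on that set.  In a maximal C*-algebra positivity can be tested in all representations.  With
`D = Δ (Δ - c) Δ` the three spectral gaps therefore compare (`BoxSpace.forall_isPositive_iff`) as
follows: `D` is positive in every representation of `ℂ[X]` if and only if it is positive on `ℓ²(X)`
and its image is positive in every representation of `C_c(∂G(X))`.

One direction only needs that the restriction `ℂ[X] → C_c(∂G(X))` is a *-homomorphism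
(`BoxSpace.restrictHom`).  This is seen on `G(X)` first, where pairs of points of `X` are dense and
convolution is matrix multiplication.

For the other direction let `π` be a representation of `ℂ[X]` on `H`, and let `Q_n ∈ ℂ[X]` be the
central projection onto `ℓ²(X_0 ∪ ... ∪ X_{n-1})`.

* On the range of `π(Q_n)`, `D` acts as `D Q_n`.  If `S` is the square root of `D` in `B(ℓ²(X))`, then
  `S` commutes with the projections onto unions of connected components, so `B = S Q_n` has finite
  propagation, and `π(D Q_n) = π(B)^* π(B)` is positive (`BoxSpace.exists_star_mul_self_eq`).
* On the orthogonal complement of all these ranges `π` kills every `Q_n`.  It then kills the kernel of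
  the restriction to the boundary (`BoxSpace.map_eq_zero_of_restrictHom_eq_zero`), which consists of
  operators whose matrix entries tend to zero.  The restriction is onto by Tietze's theorem
  (`BoxSpace.restrictHom_surjective`), so this part of `π` is a representation of `C_c(∂G(X))`, where
  `D` is positive by assumption.
-/

noncomputable section

/-! ### Spectral gaps as positivity -/

/-- A self-adjoint operator on a Hilbert space is positive if and only if its real spectrum is
nonnegative. -/
theorem ContinuousLinearMap.spectrumRestricts_nnreal_iff_isPositive {H : Type*}
    [NormedAddCommGroup H] [InnerProductSpace ℂ H] [CompleteSpace H] {T : H →L[ℂ] H}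
    (hT : IsSelfAdjoint T) :
    SpectrumRestricts T ContinuousMap.realToNNReal ↔ T.IsPositive := by
  refine ⟨fun h => ?_, fun h => h.spectrumRestricts⟩
  rw [← ContinuousLinearMap.nonneg_iff_isPositive]
  obtain ⟨p, hp, -, hpT⟩ :=
    CFC.exists_sqrt_of_isSelfAdjoint_of_quasispectrumRestricts hT h
  rw [← hpT]
  nth_rewrite 1 [← hp.star_eq]
  exact star_mul_self_nonneg p

/-- For `c > 0` the real polynomial `t (t - c) t` is nonnegative exactly on `{0} ∪ [c, ∞)`, so a
spectral gap of size `c` of a self-adjoint `a` is the positivity of `a (a - c) a`. -/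
theorem hasSpectralGap_iff {A : Type*} [CStarAlgebra A] {a : A} (ha : IsSelfAdjoint a) {c : ℝ}
    (hc : 0 < c) : BoxSpace.HasSpectralGap a c ↔
      SpectrumRestricts (a * (a - (c : ℂ) • 1) * a) ContinuousMap.realToNNReal := by
  have hpoly : a * (a - (c : ℂ) • 1) * a = cfc (fun t : ℝ => t * (t - c) * t) a := by
    rw [cfc_mul _ _ a, cfc_mul _ _ a, cfc_sub _ _ a, cfc_const c a, cfc_id' ℝ a,
      Algebra.algebraMap_eq_smul_one]
    rfl
  rw [SpectrumRestricts.nnreal_iff, hpoly, cfc_map_spectrum _ a, BoxSpace.HasSpectralGap,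
    ← ha.spectrumRestricts.algebraMap_image]
  constructor
  · rintro h _ ⟨t, ht, rfl⟩
    rcases h ⟨t, ht, rfl⟩ with h0 | ⟨s, hs, hst⟩
    · have : t = 0 := by simpa using h0
      simp [this]
    · obtain rfl : s = t := by simpa using hst
      have hs' : c ≤ s := hs
      have : 0 ≤ s - c := sub_nonneg.2 hs'
      have : 0 ≤ s := hc.le.trans hs'
      positivity
  · rintro h _ ⟨t, ht, rfl⟩
    have h1 : 0 ≤ t * (t - c) * t := h _ ⟨t, ht, rfl⟩
    by_cases h0 : t = 0
    · left
      simp [h0]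
    · right
      refine ⟨t, ?_, rfl⟩
      have h2 : 0 < t ^ 2 := by positivity
      by_contra h3
      have h4 : t < c := not_le.1 h3
      nlinarith

/-- If `a` is self-adjoint and `c` is real, then `a (a - c) a` is self-adjoint. -/
theorem IsSelfAdjoint.mul_sub_smul_one_mul {A : Type*} [Ring A] [Algebra ℂ A] [StarRing A]
    [StarModule ℂ A] {a : A} (ha : IsSelfAdjoint a) (c : ℝ) :
    IsSelfAdjoint (a * (a - (c : ℂ) • 1) * a) := by
  have h : IsSelfAdjoint (a - (c : ℂ) • (1 : A)) :=
    ha.sub (IsSelfAdjoint.smul (Complex.conj_ofReal c) (.one A))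
  simpa only [ha.star_eq] using h.conjugate a

theorem hasSpectralGap_op_iff {H : Type*} [NormedAddCommGroup H] [InnerProductSpace ℂ H]
    [CompleteSpace H] {T : H →L[ℂ] H} (hT : IsSelfAdjoint T) {c : ℝ} (hc : 0 < c) :
    BoxSpace.HasSpectralGap T c ↔ (T * (T - (c : ℂ) • 1) * T).IsPositive := by
  rw [hasSpectralGap_iff hT hc,
    ContinuousLinearMap.spectrumRestricts_nnreal_iff_isPositive (hT.mul_sub_smul_one_mul c)]

section MaxCStar

variable {A : Type u} [Ring A] [Algebra ℂ A] [StarRing A] [BoundedReps A]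

theorem norm_toMaxCStar_le {a : A} {C : ℝ} (hC : 0 ≤ C) :
    ‖(toMaxCStar a : MaxCStar A)‖ ≤ C ↔ ∀ π : StarRep A, ‖π.hom a‖ ≤ C := by
  change ‖(universalRep A a : lp (fun π : StarRep A => π.H →L[ℂ] π.H) ∞)‖ ≤ C ↔ _
  refine ⟨fun h π => ?_, fun h => lp.norm_le_of_forall_le hC h⟩
  exact (lp.norm_apply_le_norm (by simp)
    (universalRep A a : lp (fun π : StarRep A => π.H →L[ℂ] π.H) ∞) π).trans h

/-- Positivity in the maximal C*-algebra can be tested in the representations of `A`: for a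
self-adjoint `a` of norm at most `t` it says `‖t - a‖ ≤ t`, and the norm is the supremum over the
representations. -/
theorem spectrumRestricts_toMaxCStar_iff {a : A} (ha : IsSelfAdjoint a) :
    SpectrumRestricts (toMaxCStar a : MaxCStar A) ContinuousMap.realToNNReal ↔
      ∀ π : StarRep A, (π.hom a).IsPositive := by
  set t : NNReal := ‖(toMaxCStar a : MaxCStar A)‖₊ with ht
  have ht' : ∀ π : StarRep A, ‖π.hom a‖₊ ≤ t := (norm_toMaxCStar_le t.2).1 le_rfl
  rw [SpectrumRestricts.nnreal_iff_nnnorm (ha.map toMaxCStar) ht.ge]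
  have h1 : algebraMap ℝ (MaxCStar A) t - toMaxCStar a =
      toMaxCStar (((t : ℝ) : ℂ) • (1 : A) - a) := by
    rw [map_sub, map_smul, map_one, Algebra.algebraMap_eq_smul_one]
    rfl
  rw [h1, ← NNReal.coe_le_coe, coe_nnnorm, norm_toMaxCStar_le t.coe_nonneg]
  refine forall_congr' fun π => ?_
  have h2 : π.hom (((t : ℝ) : ℂ) • (1 : A) - a) = algebraMap ℝ (π.H →L[ℂ] π.H) t - π.hom a := by
    rw [map_sub, map_smul, map_one, Algebra.algebraMap_eq_smul_one]
    rfl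
  rw [h2, ← ContinuousLinearMap.spectrumRestricts_nnreal_iff_isPositive (ha.map π.hom),
    SpectrumRestricts.nnreal_iff_nnnorm (ha.map π.hom) (ht' π), ← NNReal.coe_le_coe]
  rfl

/-- A self-adjoint `a ∈ A` has spectral gap of size `c` in the maximal C*-algebra of `A` if and
only if `a (a - c) a` is positive in every representation. -/
theorem hasSpectralGap_toMaxCStar_iff [StarModule ℂ A] {a : A} (ha : IsSelfAdjoint a) {c : ℝ}
    (hc : 0 < c) :
    BoxSpace.HasSpectralGap (toMaxCStar a : MaxCStar A) c ↔
      ∀ π : StarRep A, (π.hom (a * (a - (c : ℂ) • 1) * a)).IsPositive := by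
  rw [hasSpectralGap_iff (ha.map toMaxCStar) hc,
    ← spectrumRestricts_toMaxCStar_iff (ha.mul_sub_smul_one_mul c), map_mul, map_mul, map_sub,
    map_smul, map_one]

end MaxCStar

namespace BoxSpace

variable {X : BoxSpace.{u}}

/-! ### Restriction to an invariant set as a *-homomorphism -/

variable (X) in
/-- The whole base space `βX`, so that `GroupoidAlgebra X.univSet` is `C_c(G(X))`. -/
def univSet : X.InvariantSet where
  carrier := Set.univ
  isClosed := isClosed_univ
  invariant _ := by simp

/-- The matrix entry `T_{xy} = ⟨δ_x, T δ_y⟩` of `T ∈ ℂ[X]`. -/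
def entry (T : X.roeAlgebra) (x y : X.Pt) : ℂ :=
  inner ℂ (delta x) ((T : X.L2 →L[ℂ] X.L2) (delta y))

theorem entry_eq_apply (T : X.roeAlgebra) (x y : X.Pt) :
    entry T x y = (T : X.L2 →L[ℂ] X.L2) (delta y) x := inner_delta_left _ _

theorem roeAlgebra_ext {T S : X.roeAlgebra} (h : ∀ x y, entry T x y = entry S x y) : T = S := by
  refine Subtype.ext (op_ext fun y => ?_)
  ext x
  rw [← entry_eq_apply, ← entry_eq_apply, h]

theorem entry_add (T S : X.roeAlgebra) (x y : X.Pt) :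
    entry (T + S) x y = entry T x y + entry S x y := by
  rw [entry_eq_apply, entry_eq_apply, entry_eq_apply]
  rfl

theorem entry_smul (c : ℂ) (T : X.roeAlgebra) (x y : X.Pt) :
    entry (c • T) x y = c * entry T x y := by
  rw [entry_eq_apply, entry_eq_apply]
  rfl

theorem entry_zero (x y : X.Pt) : entry (0 : X.roeAlgebra) x y = 0 := by
  rw [entry_eq_apply]
  rfl

open Classical in
theorem entry_one (x y : X.Pt) : entry (1 : X.roeAlgebra) x y = if x = y then 1 else 0 := by
  rw [entry_eq_apply]
  exact delta_apply y x

theorem entry_star (T : X.roeAlgebra) (x y : X.Pt) :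
    entry (star T) x y = starRingEnd ℂ (entry T y x) := by
  rw [entry, entry, inner_conj_symm, ← ContinuousLinearMap.adjoint_inner_right]
  rfl

theorem exists_propagation (T : X.roeAlgebra) :
    ∃ R : ℕ, ∀ x y, entry T x y ≠ 0 → X.G.edist x y ≤ R := by
  obtain ⟨R, hR⟩ := T.2
  refine ⟨R, fun x y h => ?_⟩
  by_contra h1
  refine h ?_
  rw [entry, ← inner_conj_symm, hR y x (by rw [SimpleGraph.edist_comm]; exact (not_le.1 h1).le),
    map_zero]

theorem finite_entry_row (T : X.roeAlgebra) (x : X.Pt) : {z | entry T x z ≠ 0}.Finite := by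
  obtain ⟨R, hR⟩ := exists_propagation T
  obtain ⟨N, hN⟩ := X.exists_ball_card_le R
  obtain ⟨s, -, hs⟩ := hN x
  exact s.finite_toSet.subset fun z hz => hs z (hR x z hz)

theorem entry_mul (T S : X.roeAlgebra) (x y : X.Pt) :
    entry (T * S) x y = ∑ᶠ z, entry T x z * entry S z y := by
  have h : entry (T * S) x y = inner ℂ (((star T : X.roeAlgebra) : X.L2 →L[ℂ] X.L2) (delta x))
      ((S : X.L2 →L[ℂ] X.L2) (delta y)) := by
    rw [StarMemClass.coe_star, ContinuousLinearMap.star_eq_adjoint,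
      ContinuousLinearMap.adjoint_inner_left]
    rfl
  have hfin : (Function.support fun z => entry T x z * entry S z y).Finite :=
    (finite_entry_row T x).subset fun z hz => left_ne_zero_of_mul hz
  rw [h, lp.inner_eq_tsum, ← tsum_eq_finsum (L := .unconditional _) hfin]
  refine tsum_congr fun z => ?_
  rw [← entry_eq_apply, ← entry_eq_apply, entry_star, RCLike.inner_apply, Complex.conj_conj,
    mul_comm]

theorem ext0_restrict_pure (Z : X.InvariantSet) (T : X.roeAlgebra) {x y : X.Pt}
    (hx : pure x ∈ Z.carrier) (hy : pure y ∈ Z.carrier) :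
    ext0 (restrict Z T) (pure x) (pure y) = entry T x y := by
  refine GroupoidAlgebra.ext0_induction (fun g hg => GroupoidAlgebra.ofMatrix_pure hg) fun h => ?_
  by_contra h0
  obtain ⟨R, hR⟩ := exists_propagation T
  exact h ⟨⟨⟨(pure x, pure y), R, subset_closure ⟨(x, y), hR x y h0, rfl⟩⟩, hx, hy⟩, rfl⟩

theorem ext0_restrict_univ_pure (T : X.roeAlgebra) (x y : X.Pt) :
    ext0 (restrict X.univSet T) (pure x) (pure y) = entry T x y :=
  ext0_restrict_pure _ T (Set.mem_univ _) (Set.mem_univ _)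

namespace GroupoidAlgebra

/-- A function in `C_c(G(X))` is determined by its values on the dense subset of pairs of points
of `X`. -/
theorem ext_pure {f g : GroupoidAlgebra X.univSet}
    (h : ∀ x y, ext0 f (pure x) (pure y) = ext0 g (pure x) (pure y)) : f = g := by
  refine ext fun γ => ?_
  obtain ⟨R, hR⟩ := γ.1.2
  let φ : X.cl (X.entourage R) → Reduction X.univSet :=
    fun p => ⟨CoarseGroupoid.incl R p, trivial, trivial⟩
  have hφ : Continuous φ := (CoarseGroupoid.continuous_incl R).subtype_mk _
  have hK : IsClosed (Subtype.val '' {p | f (φ p) = g (φ p)}) :=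
    IsClosed.isClosedMap_subtype_val isClosed_closure _
      (isClosed_eq (f.continuous.comp hφ) (g.continuous.comp hφ))
  obtain ⟨p, hp, hpγ⟩ := closure_minimal (by
    rintro _ ⟨q, hq, rfl⟩
    refine ⟨⟨_, subset_closure ⟨q, hq, rfl⟩⟩, ?_, rfl⟩
    change f _ = g _
    rw [← ext0_coe f, ← ext0_coe g]
    exact h q.1 q.2) hK hR
  have : φ p = γ := by
    obtain ⟨⟨v, hv⟩, hγ⟩ := γ
    obtain rfl : p.1 = v := hpγ
    rfl
  rw [← this]
  exact hp

/-- Points of `X` are only related to points of `X` in `G(X)`, so convolution of functions in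
`C_c(G(X))` is matrix multiplication on pairs of points of `X`. -/
theorem ext0_mul_pure (f g : GroupoidAlgebra X.univSet) (x y : X.Pt) :
    ext0 (f * g) (pure x) (pure y) =
      ∑ᶠ z : X.Pt, ext0 f (pure x) (pure z) * ext0 g (pure z) (pure y) := by
  rw [ext0_mul]
  classical
  rw [← finsum_mem_range (f := fun ζ : X.Beta => ext0 f (pure x) ζ * ext0 g ζ (pure y))
    Ultrafilter.pure_injective]
  refine finsum_congr fun ζ => ?_
  by_cases hζ : ζ ∈ Set.range (pure : X.Pt → X.Beta)
  · rw [finsum_eq_if, if_pos hζ]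
  · rw [finsum_eq_if, if_neg hζ]
    by_contra h0
    obtain ⟨R, hR⟩ := f.exists_support
    obtain ⟨t, rfl, -⟩ := mem_cl_entourage_iff.1 (hR _ _ (left_ne_zero_of_mul h0))
    exact hζ ⟨t x, (Ultrafilter.map_pure t x).symm⟩

variable (Z : X.InvariantSet)

/-- Restriction of functions from `G(X)` to `G(X)|_Z`. -/
def res (f : GroupoidAlgebra X.univSet) : GroupoidAlgebra Z where
  toFun g := f ⟨g.1, trivial, trivial⟩
  continuous := f.continuous.comp (continuous_subtype_val.subtype_mk _)
  hasCompactSupport := by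
    obtain ⟨R, hR⟩ := hasCompactSupport_iff.1 f.hasCompactSupport
    exact hasCompactSupport_iff.2 ⟨R, fun g hg => hR _ hg⟩

variable {Z}

theorem ext0_res (f : GroupoidAlgebra X.univSet) {ω η : X.Beta} (hω : ω ∈ Z.carrier)
    (hη : η ∈ Z.carrier) : ext0 (res Z f) ω η = ext0 f ω η := by
  by_cases h : ∃ R : ℕ, (ω, η) ∈ X.cl (X.entourage R)
  · exact (ext0_coe (res Z f) ⟨⟨(ω, η), h⟩, hω, hη⟩).trans
      (ext0_coe f ⟨⟨(ω, η), h⟩, trivial, trivial⟩).symm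
  · rw [ext0_of_not, ext0_of_not] <;>
    · rintro ⟨g, hg⟩
      exact h (hg ▸ g.1.2)

theorem ext0_ext_of_mem {f g : GroupoidAlgebra Z}
    (h : ∀ ω ∈ Z.carrier, ∀ η ∈ Z.carrier, ext0 f ω η = ext0 g ω η) : f = g :=
  ext fun x => by rw [← ext0_coe f, ← ext0_coe g]; exact h _ x.2.1 _ x.2.2

theorem res_one : res Z 1 = 1 := ext0_ext_of_mem fun ω hω η hη => by
  classical
  rw [ext0_res _ hω hη, ext0_one, ext0_one]
  simp [hω, univSet]

variable (Z) in
/-- Restriction of functions from `G(X)` to `G(X)|_Z`, as a *-homomorphism. -/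
def resHom : GroupoidAlgebra X.univSet →⋆ₐ[ℂ] GroupoidAlgebra Z where
  toFun := res Z
  map_one' := res_one
  map_mul' f g := ext0_ext_of_mem fun ω hω η hη => by
    rw [ext0_res _ hω hη, ext0_mul, ext0_mul]
    refine finsum_congr fun ζ => ?_
    by_cases hζ : ζ ∈ Z.carrier
    · rw [ext0_res _ hω hζ, ext0_res _ hζ hη]
    · have h0 : ext0 (res Z f) ω ζ = 0 := by
        by_contra h
        exact hζ (mem_of_ext0_ne h).2
      have h0' : ext0 f ω ζ = 0 := by
        by_contra h
        obtain ⟨x, hx, -⟩ := exists_of_ext0_ne h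
        have h1 : x.1.range = ω := congrArg Prod.fst hx
        have h2 : x.1.source = ζ := congrArg Prod.snd hx
        exact hζ (h2 ▸ (Z.invariant x.1).2 (h1 ▸ hω))
      rw [h0, h0', zero_mul, zero_mul]
  map_zero' := rfl
  map_add' _ _ := rfl
  commutes' c := by
    rw [Algebra.algebraMap_eq_smul_one, Algebra.algebraMap_eq_smul_one, ← res_one (Z := Z)]
    rfl
  map_star' _ := rfl

end GroupoidAlgebra

/-- The identification `ℂ[X] → C_c(G(X))`. -/
def toGroupoidAlgebra : X.roeAlgebra →⋆ₐ[ℂ] GroupoidAlgebra X.univSet where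
  toFun := restrict X.univSet
  map_one' := GroupoidAlgebra.ext_pure fun x y => by
    classical
    rw [ext0_restrict_univ_pure, entry_one, GroupoidAlgebra.ext0_one]
    simp [Ultrafilter.pure_injective.eq_iff, univSet]
  map_mul' T S := GroupoidAlgebra.ext_pure fun x y => by
    rw [ext0_restrict_univ_pure, entry_mul, GroupoidAlgebra.ext0_mul_pure]
    refine finsum_congr fun z => ?_
    rw [ext0_restrict_univ_pure, ext0_restrict_univ_pure]
  map_zero' := GroupoidAlgebra.ext_pure fun x y => by
    rw [ext0_restrict_univ_pure, entry_zero, GroupoidAlgebra.ext0_zero]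
  map_add' T S := GroupoidAlgebra.ext_pure fun x y => by
    rw [GroupoidAlgebra.ext0_add]
    simp only [ext0_restrict_univ_pure, entry_add]
  commutes' c := GroupoidAlgebra.ext_pure fun x y => by
    classical
    rw [Algebra.algebraMap_eq_smul_one, Algebra.algebraMap_eq_smul_one, ext0_restrict_univ_pure,
      entry_smul, entry_one, GroupoidAlgebra.ext0_smul, GroupoidAlgebra.ext0_one]
    simp [Ultrafilter.pure_injective.eq_iff, univSet]
  map_star' T := GroupoidAlgebra.ext_pure fun x y => by
    rw [GroupoidAlgebra.ext0_star, ext0_restrict_univ_pure,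
      ext0_restrict_univ_pure, entry_star]

/-- The map `restrict Z : ℂ[X] → C_c(G(X)|_Z)` as a *-homomorphism; the underlying functions agree
definitionally. -/
def restrictHom (Z : X.InvariantSet) : X.roeAlgebra →⋆ₐ[ℂ] GroupoidAlgebra Z :=
  (GroupoidAlgebra.resHom Z).comp toGroupoidAlgebra

/-! ### Surjectivity of the restriction -/

/-- A matrix of finite propagation with bounded entries is the matrix of an operator in `ℂ[X]`. -/
theorem exists_entry_eq {T : X.Pt → X.Pt → ℂ} {C : ℝ} (hC : ∀ x y, ‖T x y‖ ≤ C) {R : ℕ}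
    (hR : ∀ x y, T x y ≠ 0 → X.G.edist x y ≤ R) :
    ∃ S : X.roeAlgebra, ∀ x y, entry S x y = T x y := by
  classical
  obtain ⟨N, hN⟩ := X.exists_ball_card_le R
  choose t ht ht' using hN
  let s : X.Pt → Finset X.Pt := fun x => (t x).filter fun y => X.G.edist x y ≤ R
  have hs : ∀ x y, y ∈ s x ↔ X.G.edist x y ≤ R := fun x y => by
    simp only [s, Finset.mem_filter, and_iff_right_iff_imp]
    exact ht' x y
  have hscard : ∀ x, ((s x).card : ℝ) ≤ N := fun x => by
    exact_mod_cast (Finset.card_filter_le _ _).trans (ht x)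
  have hssymm : ∀ x y, y ∈ s x ↔ x ∈ s y := fun x y => by
    rw [hs, hs, SimpleGraph.edist_comm]
  let L : (X.Pt → ℂ) →ₗ[ℂ] (X.Pt → ℂ) :=
    { toFun := fun f x => ∑ y ∈ s x, T x y * f y
      map_add' := fun f g => by
        funext x
        simp only [Pi.add_apply, mul_add, Finset.sum_add_distrib]
      map_smul' := fun c f => by
        funext x
        simp only [Pi.smul_apply, smul_eq_mul, RingHom.id_apply, Finset.mul_sum, mul_left_comm] }
  have hL : ∀ f x, ‖L f x‖ ^ 2 ≤ N * C ^ 2 * ∑ y ∈ s x, ‖f y‖ ^ 2 := by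
    intro f x
    calc ‖L f x‖ ^ 2 ≤ (∑ y ∈ s x, ‖T x y * f y‖) ^ 2 := by
          gcongr
          exact norm_sum_le _ _
      _ ≤ (s x).card * ∑ y ∈ s x, ‖T x y * f y‖ ^ 2 := sq_sum_le_card_mul_sum_sq
      _ ≤ N * ∑ y ∈ s x, C ^ 2 * ‖f y‖ ^ 2 := by
          gcongr with y _
          · exact_mod_cast hscard x
          · rw [norm_mul, mul_pow]
            gcongr
            exact hC x y
      _ = _ := by rw [← Finset.mul_sum, mul_assoc]
  have hsum : ∀ (f : X.L2) (F : Finset X.Pt),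
      ∑ x ∈ F, ∑ y ∈ s x, ‖f y‖ ^ 2 ≤ N * ‖f‖ ^ 2 := by
    intro f F
    calc ∑ x ∈ F, ∑ y ∈ s x, ‖f y‖ ^ 2
        = ∑ y ∈ F.biUnion s, ∑ x ∈ F.filter (· ∈ s y), ‖f y‖ ^ 2 := by
          refine Finset.sum_comm' fun x y => ?_
          simp only [Finset.mem_filter, Finset.mem_biUnion]
          exact ⟨fun h => ⟨⟨h.1, (hssymm x y).1 h.2⟩, x, h.1, h.2⟩,
            fun h => ⟨h.1.1, (hssymm x y).2 h.1.2⟩⟩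
      _ ≤ ∑ y ∈ F.biUnion s, N * ‖f y‖ ^ 2 := by
          refine Finset.sum_le_sum fun y _ => ?_
          rw [Finset.sum_const, nsmul_eq_mul]
          gcongr
          exact (Finset.card_le_card fun x hx => (Finset.mem_filter.1 hx).2).trans
            (by exact_mod_cast hscard y)
      _ ≤ N * ‖f‖ ^ 2 := by
          rw [← Finset.mul_sum]
          gcongr
          exact sum_sq_le f _
  let A : X.L2 →L[ℂ] X.L2 := opOfBound L (N * |C|) (by positivity) fun f F =>
    calc ∑ x ∈ F, ‖L f x‖ ^ 2 ≤ ∑ x ∈ F, N * C ^ 2 * ∑ y ∈ s x, ‖f y‖ ^ 2 :=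
          Finset.sum_le_sum fun x _ => hL f x
      _ ≤ N * C ^ 2 * (N * ‖f‖ ^ 2) := by
          rw [← Finset.mul_sum]
          exact mul_le_mul_of_nonneg_left (hsum f F) (by positivity)
      _ = _ := by rw [mul_pow, mul_pow, sq_abs]; ring
  have hA : ∀ x y, A (delta y) x = T x y := by
    intro x y
    change ∑ z ∈ s x, T x z * (delta y : X.L2) z = _
    simp only [delta_apply, mul_ite, mul_one, mul_zero, Finset.sum_ite_eq']
    split_ifs with h
    · rfl
    · by_contra h0
      exact h ((hs x y).2 (hR x y (Ne.symm h0)))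
  refine ⟨⟨A, R + 1, fun x y h => ?_⟩, fun x y => (inner_delta_left _ _).trans (hA x y)⟩
  rw [← inner_conj_symm, inner_delta_left, hA]
  have : T y x = 0 := by
    by_contra h0
    have h1 := hR y x h0
    rw [SimpleGraph.edist_comm] at h1
    have h2 := h.trans h1
    have h3 : R + 1 ≤ R := by exact_mod_cast h2
    omega
  rw [this, map_zero]

theorem CoarseGroupoid.val_injective : Function.Injective (CoarseGroupoid.val (X := X)) := by
  rintro ⟨v, _⟩ ⟨_, _⟩ rfl
  rfl

/-- Every function in `C_c(G(X)|_Z)` comes from a matrix: it is a continuous function on a closed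
set of ultrafilters on `X × X`, and extends by Tietze's theorem. -/
theorem restrictHom_surjective (Z : X.InvariantSet) : Function.Surjective (restrictHom Z) := by
  classical
  intro f
  obtain ⟨R, hR⟩ := GroupoidAlgebra.hasCompactSupport_iff.1 f.hasCompactSupport
  let K : Set (Ultrafilter (X.Pt × X.Pt)) :=
    {Ω | X.entourage R ∈ Ω} ∩ {Ω | Ω.map Prod.fst ∈ Z.carrier}
  have hK : IsClosed K := (ultrafilter_isClosed_basic _).inter
    (Z.isClosed.preimage (continuous_fst.comp continuous_marginals))
  have hcl : ∀ Ω : K, (Ω.1.map Prod.fst, Ω.1.map Prod.snd) ∈ X.cl (X.entourage R) :=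
    fun Ω => mem_cl_iff.2 ⟨Ω.1, Ω.2.1, rfl⟩
  let γ : K → X.CoarseGroupoid := fun Ω => ⟨(Ω.1.map Prod.fst, Ω.1.map Prod.snd), R, hcl Ω⟩
  have hγ : Continuous γ :=
    CoarseGroupoid.continuous_of_bounded (continuous_marginals.comp continuous_subtype_val) hcl
  have hγZ : ∀ Ω, (γ Ω).range ∈ Z.carrier ∧ (γ Ω).source ∈ Z.carrier :=
    fun Ω => ⟨Ω.2.2, (Z.invariant (γ Ω)).2 Ω.2.2⟩
  let φ : C(K, ℂ) := ⟨fun Ω => f ⟨γ Ω, hγZ Ω⟩, f.continuous.comp (hγ.subtype_mk hγZ)⟩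
  obtain ⟨F, hF⟩ := φ.exists_restrict_eq hK
  obtain ⟨C, hC⟩ := (isCompact_range F.continuous).isBounded.exists_norm_le
  let T : X.Pt → X.Pt → ℂ := fun x y => if X.G.edist x y ≤ R then F (pure (x, y)) else 0
  have hTC : ∀ x y, ‖T x y‖ ≤ max C 0 := by
    intro x y
    simp only [T]
    split_ifs
    · exact (hC _ ⟨_, rfl⟩).trans (le_max_left _ _)
    · simp
  obtain ⟨S, hS⟩ := exists_entry_eq hTC (R := R) fun x y h => by
    by_contra h0
    exact h (if_neg h0)
  refine ⟨S, GroupoidAlgebra.ext fun g => ?_⟩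
  change limUnder (g.1.lift : Filter (X.Pt × X.Pt)) (fun p => entry S p.1 p.2) = f g
  simp only [hS]
  by_cases hg : g.1.1 ∈ X.cl (X.entourage R)
  · have hΩ := CoarseGroupoid.entourage_mem_lift.2 hg
    have hm := g.1.lift_marginals
    have hmem : g.1.lift ∈ K := ⟨hΩ, by
      have h : g.1.lift.map Prod.fst = g.1.range := congrArg Prod.fst hm
      rw [Set.mem_ofPred_eq, h]
      exact g.2.1⟩
    have h1 : Tendsto (fun p => F (pure p)) g.1.lift (𝓝 (F g.1.lift)) :=
      (F.continuous.tendsto _).comp (Ultrafilter.tendsto_pure_self _)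
    have h2 : F g.1.lift = f g := by
      refine (DFunLike.congr_fun hF ⟨g.1.lift, hmem⟩).trans ?_
      change f _ = f g
      congr 1
      exact Subtype.ext (CoarseGroupoid.val_injective hm)
    rw [← h2]
    refine Tendsto.limUnder_eq (h1.congr' ?_)
    filter_upwards [hΩ] with p hp
    exact (if_pos hp).symm
  · have h0 : f g = 0 := by
      by_contra h
      exact hg (hR g h)
    rw [h0]
    refine Tendsto.limUnder_eq (tendsto_const_nhds.congr' ?_)
    filter_upwards [Ultrafilter.compl_mem_iff_notMem.2
      (fun h => hg (CoarseGroupoid.entourage_mem_lift.1 h))] with p hp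
    exact (if_neg hp).symm

end BoxSpace

/-- A *-homomorphism factors through a surjective *-homomorphism with smaller kernel. -/
theorem StarAlgHom.exists_comp_eq_of_surjective {A B C : Type*} [Ring A] [Algebra ℂ A] [StarRing A]
    [Ring B] [Algebra ℂ B] [StarRing B] [Ring C] [Algebra ℂ C] [StarRing C] (f : A →⋆ₐ[ℂ] B)
    (g : A →⋆ₐ[ℂ] C) (hf : Function.Surjective f) (h : ∀ a, f a = 0 → g a = 0) :
    ∃ k : B →⋆ₐ[ℂ] C, ∀ a, k (f a) = g a := by
  have h' : ∀ a b, f a = f b → g a = g b := fun a b hab => by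
    rw [← sub_eq_zero, ← map_sub]
    exact h _ (by rw [map_sub, hab, sub_self])
  choose s hs using hf
  exact ⟨{ toFun := fun b => g (s b)
           map_one' := by rw [h' _ 1 (by rw [hs, map_one]), map_one]
           map_mul' := fun x y => by rw [h' _ (s x * s y) (by rw [map_mul, hs, hs, hs]), map_mul]
           map_zero' := by rw [h' _ 0 (by rw [hs, map_zero]), map_zero]
           map_add' := fun x y => by rw [h' _ (s x + s y) (by rw [map_add, hs, hs, hs]), map_add]
           commutes' := fun c => by
            rw [h' _ (algebraMap ℂ A c) (by rw [hs, AlgHomClass.commutes]), AlgHomClass.commutes]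
           map_star' := fun x => by rw [h' _ (star (s x)) (by rw [map_star, hs, hs]), map_star] },
    fun a => h' _ _ (hs _)⟩

namespace BoxSpace

variable {X : BoxSpace.{u}}

/-! ### Diagonal operators -/

variable (X) in
/-- The C*-algebra `ℓ^∞(X)`. -/
abbrev LInf : Type u := lp (fun _ : X.Pt => ℂ) ∞

instance : CStarAlgebra X.LInf where

theorem norm_LInf_le (a : X.LInf) (x : X.Pt) : ‖a x‖ ≤ ‖a‖ := lp.norm_apply_le_norm (by simp) a x

/-- The inclusion of `ℓ^∞(X)` into `ℂ[X]` as diagonal operators. -/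
def diag : X.LInf →⋆ₐ[ℂ] X.roeAlgebra where
  toFun a := ⟨diagOp a ‖a‖ (norm_nonneg a) (norm_LInf_le a), diagOp_mem⟩
  map_one' := Subtype.ext (ContinuousLinearMap.ext fun f => by ext x; exact one_mul _)
  map_mul' a b := Subtype.ext (ContinuousLinearMap.ext fun f => by ext x; exact mul_assoc _ _ _)
  map_zero' := Subtype.ext (ContinuousLinearMap.ext fun f => by ext x; exact zero_mul _)
  map_add' a b := Subtype.ext (ContinuousLinearMap.ext fun f => by ext x; exact add_mul _ _ _)
  commutes' c := Subtype.ext (ContinuousLinearMap.ext fun f => by ext x; rfl)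
  map_star' a := roeAlgebra_ext fun x y => by
    classical
    have h : ∀ (a : X.LInf) x y, entry (⟨diagOp a ‖a‖ (norm_nonneg a) (norm_LInf_le a),
        diagOp_mem⟩ : X.roeAlgebra) x y = a x * (delta y : X.L2) x := fun a x y =>
      entry_eq_apply _ _ _
    rw [entry_star, h, h, delta_apply, delta_apply]
    by_cases hxy : x = y
    · subst hxy
      simp
    · simp [hxy, Ne.symm hxy]

theorem diag_apply (a : X.LInf) (f : X.L2) (x : X.Pt) :
    (diag a : X.L2 →L[ℂ] X.L2) f x = a x * f x := rfl

theorem entry_diag_mul (a : X.LInf) (T : X.roeAlgebra) (x y : X.Pt) :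
    entry (diag a * T) x y = a x * entry T x y := by
  rw [entry_eq_apply, entry_eq_apply]
  rfl

theorem entry_mul_diag (a : X.LInf) (T : X.roeAlgebra) (x y : X.Pt) :
    entry (T * diag a) x y = entry T x y * a y := by
  have h : T * diag a = star (diag (star a) * star T) := by
    rw [star_mul, map_star, star_star, star_star]
  rw [h, entry_star, entry_diag_mul, entry_star, map_mul, Complex.conj_conj, mul_comm]
  simp

open Classical in
theorem entry_diag (a : X.LInf) (x y : X.Pt) :
    entry (diag a) x y = if x = y then a x else 0 := by
  rw [← mul_one (diag a), entry_diag_mul, entry_one, mul_ite, mul_one, mul_zero]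

theorem exists_eq_diag {T : X.roeAlgebra} (h : ∀ x y, x ≠ y → entry T x y = 0) :
    ∃ a : X.LInf, T = diag a := by
  classical
  have hδ : ∀ x, ‖(delta x : X.L2)‖ = 1 := fun x => by
    rw [delta, lp.norm_single (by simp)]
    simp
  refine ⟨⟨fun x => entry T x x, memℓp_infty ⟨‖(T : X.L2 →L[ℂ] X.L2)‖, ?_⟩⟩, ?_⟩
  · rintro _ ⟨x, rfl⟩
    refine (norm_inner_le_norm _ _).trans ?_
    rw [hδ, one_mul]
    refine ((T : X.L2 →L[ℂ] X.L2).le_opNorm _).trans ?_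
    rw [hδ, mul_one]
  · refine roeAlgebra_ext fun x y => ?_
    rw [entry_diag]
    split_ifs with hxy
    · rw [hxy]
    · exact h x y hxy

open Classical in
/-- The indicator function of a set, as an element of `ℓ^∞(X)`. -/
def ind (s : Set X.Pt) : X.LInf :=
  ⟨fun x => if x ∈ s then 1 else 0, memℓp_infty ⟨1, by
    rintro _ ⟨x, rfl⟩
    dsimp only
    split_ifs <;> simp⟩⟩

open Classical in
theorem ind_apply (s : Set X.Pt) (x : X.Pt) : ind s x = if x ∈ s then 1 else 0 := rfl

theorem star_ind (s : Set X.Pt) : star (ind s) = ind s := by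
  ext x
  rw [lp.star_apply, ind_apply]
  split_ifs <;> simp

theorem ind_mul_ind {s t : Set X.Pt} (h : s ⊆ t) : ind t * ind s = ind s := by
  ext x
  change ind t x * ind s x = ind s x
  rw [ind_apply, ind_apply]
  by_cases hs : x ∈ s
  · simp [hs, h hs]
  · simp [hs]

/-- A union of connected components defines a central projection of `ℂ[X]`. -/
theorem commute_diag_ind {s : Set X.Pt} (hs : ∀ x y, X.G.edist x y ≠ ⊤ → (x ∈ s ↔ y ∈ s))
    (T : X.roeAlgebra) : Commute (diag (ind s)) T := by
  refine roeAlgebra_ext fun x y => ?_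
  rw [entry_diag_mul, entry_mul_diag]
  by_cases h : entry T x y = 0
  · simp [h]
  · obtain ⟨R, hR⟩ := exists_propagation T
    have := hs x y (ne_top_of_le_ne_top (ENat.natCast_ne_top _) (hR x y h))
    rw [ind_apply, ind_apply]
    by_cases hy : y ∈ s
    · rw [if_pos (this.2 hy), if_pos hy, mul_comm]
    · rw [if_neg (mt this.1 hy), if_neg hy, mul_comm]

variable (X) in
/-- The finite set `X_0 ∪ ... ∪ X_{n-1}`. -/
def initial (n : ℕ) : Set X.Pt := {x | x.1 < n}

theorem initial_mono {m n : ℕ} (h : m ≤ n) : X.initial m ⊆ X.initial n :=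
  fun _ hx => lt_of_lt_of_le (show _ < m from hx) h

theorem finite_initial (n : ℕ) : (X.initial n).Finite := by
  have : ∀ i, Finite (X.V i) := X.finite
  refine (Set.finite_range fun p : Σ i : Fin n, X.V i => (⟨p.1, p.2⟩ : X.Pt)).subset ?_
  rintro ⟨i, v⟩ hi
  exact ⟨⟨⟨i, hi⟩, v⟩, rfl⟩

theorem fst_eq_of_edist_ne_top {x y : X.Pt} (h : X.G.edist x y ≠ ⊤) : x.1 = y.1 := by
  obtain ⟨p, -⟩ := SimpleGraph.exists_walk_of_edist_ne_top h
  induction p with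
  | nil => rfl
  | cons hadj p ih =>
    obtain ⟨i, v, w, -, rfl, rfl⟩ := hadj
    exact ih (SimpleGraph.edist_ne_top_iff_reachable.2 ⟨p⟩)

theorem mem_initial_iff {n : ℕ} {x y : X.Pt} (h : X.G.edist x y ≠ ⊤) :
    x ∈ X.initial n ↔ y ∈ X.initial n := by
  change x.1 < n ↔ y.1 < n
  rw [fst_eq_of_edist_ne_top h]

/-! ### The kernel of the restriction to the boundary -/

/-- If a diagonal operator vanishes on the boundary, then its entries tend to zero. -/
theorem exists_norm_lt_of_restrictHom_diag_eq_zero {a : X.LInf}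
    (h : restrictHom X.boundary (diag a) = 0) {ε : ℝ} (hε : 0 < ε) :
    ∃ n, ∀ x ∉ X.initial n, ‖a x‖ < ε := by
  classical
  have hfin : {x | ε ≤ ‖a x‖}.Finite := by
    by_contra hinf
    let F : Filter X.Pt := cofinite ⊓ 𝓟 {x | ε ≤ ‖a x‖}
    have : F.NeBot := cofinite_inf_principal_neBot_iff.2 hinf
    let η : X.Beta := Ultrafilter.of F
    have hη : (η : Filter X.Pt) ≤ F := Ultrafilter.of_le F
    have hηb : η ∈ X.boundary.carrier := by
      rintro ⟨x, hx⟩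
      have h1 : ({x}ᶜ : Set X.Pt) ∈ η :=
        hη (mem_inf_of_left (Set.finite_singleton x).compl_mem_cofinite)
      rw [← hx] at h1
      exact h1 rfl
    obtain ⟨l, -, hl⟩ := (isCompact_closedBall (0 : ℂ) ‖a‖).ultrafilter_le_nhds (η.map a) (by
      rw [le_principal_iff]
      change a ⁻¹' Metric.closedBall 0 ‖a‖ ∈ (η : Filter X.Pt)
      exact Filter.univ_mem' fun x => by simpa using norm_LInf_le a x)
    have hl' : Tendsto a η (𝓝 l) := hl
    have hlε : ε ≤ ‖l‖ := ge_of_tendsto hl'.norm (hη (mem_inf_of_right (mem_principal_self _)))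
    let g : Reduction X.boundary :=
      ⟨⟨(η, η), 0, mem_cl_entourage_zero.2 rfl⟩, hηb, hηb⟩
    have hlift : g.1.lift = η.map fun x => (x, x) := by
      refine g.1.lift_eq (R := 0) ?_ ?_
      · change (fun x => (x, x)) ⁻¹' X.entourage 0 ∈ (η : Filter X.Pt)
        exact Filter.univ_mem' fun x => by simp [entourage]
      · rw [Ultrafilter.map_map, Ultrafilter.map_map]
        exact congrArg₂ Prod.mk (Ultrafilter.map_id η) (Ultrafilter.map_id η)
    have h0 : limUnder (g.1.lift : Filter (X.Pt × X.Pt)) (fun p => entry (diag a) p.1 p.2) = 0 :=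
      congrArg (fun f : GroupoidAlgebra X.boundary => f g) h
    have hl0 : l = 0 := by
      rw [← h0, hlift]
      refine (Tendsto.limUnder_eq ?_).symm
      rw [Ultrafilter.coe_map, tendsto_map'_iff]
      refine hl'.congr fun x => ?_
      simp [entry_diag]
    rw [hl0, norm_zero] at hlε
    exact absurd hlε (not_le.2 hε)
  obtain ⟨n, hn⟩ := (hfin.image Sigma.fst).bddAbove
  refine ⟨n + 1, fun x hx => not_le.1 fun hle => hx ?_⟩
  exact Nat.lt_succ_of_le (hn ⟨x, hle, rfl⟩)

section Kernel

variable {H : Type*} [NormedAddCommGroup H] [InnerProductSpace ℂ H] [CompleteSpace H]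
  {ρ : X.roeAlgebra →⋆ₐ[ℂ] (H →L[ℂ] H)}

theorem map_diag_eq_zero (hρ : ∀ n, ρ (diag (ind (X.initial n))) = 0) {a : X.LInf}
    (ha : restrictHom X.boundary (diag a) = 0) : ρ (diag a) = 0 := by
  rw [← norm_le_zero_iff]
  refine le_of_forall_pos_le_add fun ε hε => ?_
  obtain ⟨n, hn⟩ := exists_norm_lt_of_restrictHom_diag_eq_zero ha hε
  have h1 : ρ (diag a) = (ρ.comp diag) (a - a * ind (X.initial n)) := by
    change _ = ρ (diag (a - a * ind (X.initial n)))
    rw [map_sub, map_mul, map_sub, map_mul, hρ, mul_zero, sub_zero]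
  rw [h1, zero_add]
  refine (NonUnitalStarAlgHom.norm_apply_le (ρ.comp diag) _).trans ?_
  refine lp.norm_le_of_forall_le hε.le fun x => ?_
  change ‖a x - a x * ind (X.initial n) x‖ ≤ ε
  rw [ind_apply]
  split_ifs with hx
  · simpa using hε.le
  · simpa using (hn x hx).le

/-- A representation of `ℂ[X]` that kills the operators supported on finitely many `X_i` kills all
operators that vanish on the boundary.  After splitting the columns into finitely many sparse
colour classes, `b^* b` is diagonal and has entries tending to zero. -/
theorem map_eq_zero_of_restrictHom_eq_zero (hρ : ∀ n, ρ (diag (ind (X.initial n))) = 0)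
    {T : X.roeAlgebra} (hT : restrictHom X.boundary T = 0) : ρ T = 0 := by
  classical
  obtain ⟨R, hR⟩ := exists_propagation T
  obtain ⟨N, c, -, -, hc⟩ := X.exists_translations R
  let p : Fin N → X.roeAlgebra := fun k => diag (ind {x | c x = k})
  have hp : ∑ k, p k = 1 := by
    have : ∑ k, (ind {x | c x = k} : X.LInf) = 1 := by
      ext x
      rw [lp.coeFn_sum, Finset.sum_apply]
      simp only [ind_apply, Set.mem_ofPred_eq, lp.infty_coeFn_one, Pi.one_apply]
      exact (Finset.sum_eq_single (c x) (fun k _ hk => if_neg hk.symm)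
        fun h => absurd (Finset.mem_univ _) h).trans (if_pos rfl)
    rw [← map_sum, this, map_one]
  have hzero : ∀ k, ρ (T * p k) = 0 := by
    intro k
    have hb : ∀ x y, entry (T * p k) x y ≠ 0 → X.G.edist x y ≤ R ∧ c y = k := by
      intro x y h
      rw [entry_mul_diag, ind_apply] at h
      refine ⟨hR x y (left_ne_zero_of_mul h), ?_⟩
      by_contra h0
      exact right_ne_zero_of_mul h (if_neg h0)
    obtain ⟨a, ha⟩ := exists_eq_diag (T := star (T * p k) * (T * p k)) fun x y hxy => by
      rw [entry_mul]
      refine (finsum_congr fun z => ?_).trans finsum_zero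
      by_contra h0
      rw [entry_star] at h0
      obtain ⟨h1, h1'⟩ := hb z x fun h => h0 (by rw [h, map_zero, zero_mul])
      obtain ⟨h2, h2'⟩ := hb z y (right_ne_zero_of_mul h0)
      refine hxy (hc x y ?_ (h1'.trans h2'.symm))
      refine (SimpleGraph.edist_triangle (v := z)).trans ?_
      rw [Nat.cast_add, SimpleGraph.edist_comm (u := x)]
      exact add_le_add h1 h2
    have h0 : ρ (star (T * p k) * (T * p k)) = 0 := by
      rw [ha]
      refine map_diag_eq_zero hρ ?_
      rw [← ha, map_mul, map_mul, hT, zero_mul, mul_zero]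
    rwa [map_mul, map_star, CStarRing.star_mul_self_eq_zero_iff] at h0
  rw [← mul_one T, ← hp, Finset.mul_sum, map_sum]
  exact Finset.sum_eq_zero fun k _ => hzero k

end Kernel

end BoxSpace

/-! ### Invariant subspaces and square roots -/

section Subrepresentation

variable {A : Type*} [Ring A] [Algebra ℂ A] [StarRing A] {H : Type*} [NormedAddCommGroup H]
  [InnerProductSpace ℂ H] [CompleteSpace H]

/-- The restriction of a representation of a *-algebra to a closed invariant subspace. -/
def StarAlgHom.subrep (π : A →⋆ₐ[ℂ] (H →L[ℂ] H)) (W : Submodule ℂ H) [CompleteSpace W]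
    (hW : ∀ a, ∀ w ∈ W, π a w ∈ W) : A →⋆ₐ[ℂ] (W →L[ℂ] W) where
  toFun a := ((π a).comp W.subtypeL).codRestrict W fun w => hW a w w.2
  map_one' := by
    ext w
    simp
  map_mul' a b := by
    refine ContinuousLinearMap.ext fun w => Subtype.ext ?_
    change π _ (w : H) = _
    rw [map_mul]
    rfl
  map_zero' := by
    ext w
    simp
  map_add' a b := by
    refine ContinuousLinearMap.ext fun w => Subtype.ext ?_
    change π _ (w : H) = _
    rw [map_add]
    rfl
  commutes' c := by
    ext w
    simp [Algebra.algebraMap_eq_smul_one]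
  map_star' a := by
    rw [ContinuousLinearMap.star_eq_adjoint, ContinuousLinearMap.eq_adjoint_iff]
    intro v w
    change inner ℂ (π (star a) v) (w : H) = inner ℂ (v : H) (π a w)
    rw [map_star, ContinuousLinearMap.star_eq_adjoint, ContinuousLinearMap.adjoint_inner_left]

theorem StarAlgHom.map_mul_apply (π : A →⋆ₐ[ℂ] (H →L[ℂ] H)) (a b : A) (v : H) :
    π (a * b) v = π a (π b v) := by
  rw [map_mul]
  rfl

theorem StarAlgHom.inner_map_star_left (π : A →⋆ₐ[ℂ] (H →L[ℂ] H)) (a : A) (v w : H) :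
    inner ℂ (π (star a) v) w = inner ℂ v (π a w) := by
  rw [map_star, ContinuousLinearMap.star_eq_adjoint, ContinuousLinearMap.adjoint_inner_left]

end Subrepresentation

/-- The positive square root of a positive operator `T` commutes with everything that commutes with
`T`. -/
theorem ContinuousLinearMap.IsPositive.exists_sqrt {H : Type*} [NormedAddCommGroup H]
    [InnerProductSpace ℂ H] [CompleteSpace H] {T : H →L[ℂ] H} (hT : T.IsPositive) :
    ∃ S : H →L[ℂ] H, IsSelfAdjoint S ∧ S * S = T ∧ ∀ B, Commute T B → Commute S B := by
  have hT0 : 0 ≤ T := (ContinuousLinearMap.nonneg_iff_isPositive _).2 hT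
  refine ⟨CFC.sqrt T, IsSelfAdjoint.of_nonneg (CFC.sqrt_nonneg T), CFC.sqrt_mul_sqrt_self T hT0,
    fun B hB => ?_⟩
  rw [CFC.sqrt_eq_cfc]
  exact hB.cfc_nnreal _

/-- A self-adjoint operator is positive if it is positive on a closed subspace and on its orthogonal
complement, and leaves the latter invariant. -/
theorem ContinuousLinearMap.isPositive_of_orthogonal_decomposition {H : Type*}
    [NormedAddCommGroup H] [InnerProductSpace ℂ H] [CompleteSpace H] {T : H →L[ℂ] H}
    (hT : IsSelfAdjoint T) {M : Submodule ℂ H} (hinv : ∀ v ∈ Mᗮ, T v ∈ Mᗮ)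
    (h : ∀ v ∈ M.topologicalClosure, 0 ≤ T.reApplyInnerSelf v)
    (h' : ∀ v ∈ Mᗮ, 0 ≤ T.reApplyInnerSelf v) : T.IsPositive := by
  refine ContinuousLinearMap.isPositive_def'.2 ⟨hT, fun v => ?_⟩
  have hM : IsClosed (M.topologicalClosure : Set H) := M.isClosed_topologicalClosure
  have : CompleteSpace M.topologicalClosure := hM.completeSpace_coe
  rw [← Submodule.orthogonal_closure] at hinv h'
  obtain ⟨v₁, h₁, v₂, h₂, rfl⟩ := M.topologicalClosure.exists_add_mem_mem_orthogonal v
  have hcross : (inner ℂ (T v₂) v₁ : ℂ) = 0 :=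
    Submodule.inner_left_of_mem_orthogonal h₁ (hinv v₂ h₂)
  have hcross' : (inner ℂ (T v₁) v₂ : ℂ) = 0 := by
    rw [← ContinuousLinearMap.adjoint_inner_right, ← ContinuousLinearMap.star_eq_adjoint,
      hT.star_eq]
    exact Submodule.inner_right_of_mem_orthogonal h₁ (hinv v₂ h₂)
  have h3 := add_nonneg (h v₁ h₁) (h' v₂ h₂)
  rw [ContinuousLinearMap.reApplyInnerSelf_apply, ContinuousLinearMap.reApplyInnerSelf_apply] at h3
  rw [ContinuousLinearMap.reApplyInnerSelf_apply, map_add, inner_add_left, inner_add_right,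
    inner_add_right, hcross, hcross', zero_add, add_zero, map_add]
  exact h3

namespace BoxSpace

variable {X : BoxSpace.{u}}

/-! ### Positivity in representations of the algebraic Roe algebra -/

/-- An operator that respects the decomposition of `ℓ²(X)` into connected components, cut down to
finitely many `X_i`, is a finite matrix and has finite propagation. -/
theorem mul_diag_initial_mem_roeAlgebra {A : X.L2 →L[ℂ] X.L2}
    (hA : ∀ s : Set X.Pt, (∀ x y, X.G.edist x y ≠ ⊤ → (x ∈ s ↔ y ∈ s)) →
      Commute A (diag (ind s) : X.L2 →L[ℂ] X.L2)) (n : ℕ) :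
    A * (diag (ind (X.initial n)) : X.L2 →L[ℂ] X.L2) ∈ X.roeAlgebra := by
  classical
  have hδ : ∀ (s : Set X.Pt) (x : X.Pt), (diag (ind s) : X.L2 →L[ℂ] X.L2) (delta x) =
      if x ∈ s then delta x else 0 := fun s x => by
    ext y
    rw [diag_apply, ind_apply]
    by_cases hxy : y = x
    · subst hxy
      split_ifs <;> simp
    · split_ifs <;> simp [delta_apply, hxy]
  obtain ⟨R, hR⟩ := (((finite_initial (X := X) n).prod (finite_initial n)).image
    fun p => (X.G.edist p.1 p.2).toNat).bddAbove
  refine ⟨R + 1, fun x y h => ?_⟩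
  rw [mul_apply_eq_comp, hδ]
  split_ifs with hx
  · have htop : X.G.edist x y = ⊤ := by
      by_contra htop
      have hy := (mem_initial_iff htop).1 hx
      have h1 : (X.G.edist x y).toNat ≤ R := hR ⟨(x, y), ⟨hx, hy⟩, rfl⟩
      rw [← ENat.natCast_toNat htop] at h
      have h2 : R + 1 ≤ (X.G.edist x y).toNat := by exact_mod_cast h
      omega
    let s : Set X.Pt := {z | X.G.edist x z ≠ ⊤}
    have hs : ∀ y z, X.G.edist y z ≠ ⊤ → (y ∈ s ↔ z ∈ s) := by
      intro y z hyz
      simp only [s, Set.mem_ofPred_eq, SimpleGraph.edist_ne_top_iff_reachable] at hyz ⊢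
      exact ⟨fun h => h.trans hyz, fun h => h.trans hyz.symm⟩
    have hxs : x ∈ s := by simp [s]
    have h1 : A (delta x) = (diag (ind s) : X.L2 →L[ℂ] X.L2) (A (delta x)) := by
      have h2 := congrArg (fun T : X.L2 →L[ℂ] X.L2 => T (delta x)) (hA s hs).eq
      simp only [mul_apply_eq_comp, hδ, if_pos hxs] at h2
      exact h2
    have hys : y ∉ s := not_not.2 htop
    rw [← inner_conj_symm, inner_delta_left, h1, diag_apply, ind_apply, if_neg hys, zero_mul,
      map_zero]
  · rw [map_zero, inner_zero_left]

variable (X) in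
/-- The projection onto `ℓ²(X_0 ∪ ... ∪ X_{n-1})`. -/
def initialProj (n : ℕ) : X.roeAlgebra := diag (ind (X.initial n))

theorem star_initialProj (n : ℕ) : star (X.initialProj n) = X.initialProj n := by
  rw [initialProj, ← map_star, star_ind]

theorem initialProj_mul_initialProj {m n : ℕ} (h : m ≤ n) :
    X.initialProj n * X.initialProj m = X.initialProj m := by
  rw [initialProj, initialProj, ← map_mul, ind_mul_ind (initial_mono h)]

theorem commute_initialProj (n : ℕ) (T : X.roeAlgebra) : Commute (X.initialProj n) T :=
  commute_diag_ind (fun _ _ => mem_initial_iff) T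

/-- If `D ∈ ℂ[X]` is positive on `ℓ²(X)`, then its restriction to finitely many `X_i` is of the form
`B^* B` with `B ∈ ℂ[X]`, hence positive in every representation. -/
theorem exists_star_mul_self_eq {D : X.roeAlgebra} (hD : (D : X.L2 →L[ℂ] X.L2).IsPositive)
    (n : ℕ) : ∃ B : X.roeAlgebra, star B * B = D * X.initialProj n := by
  obtain ⟨S, hS, hSS, hScomm⟩ := hD.exists_sqrt
  replace hS := hS.star_eq
  have hmem := mul_diag_initial_mem_roeAlgebra (fun s hs =>
    hScomm _ (congrArg Subtype.val (commute_diag_ind hs D).eq).symm) n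
  refine ⟨⟨_, hmem⟩, Subtype.ext ?_⟩
  change star (S * (X.initialProj n : X.L2 →L[ℂ] X.L2)) *
    (S * (X.initialProj n : X.L2 →L[ℂ] X.L2)) = D * X.initialProj n
  have hQ : star (X.initialProj n : X.L2 →L[ℂ] X.L2) = X.initialProj n :=
    congrArg Subtype.val (star_initialProj n)
  have hQQ : (X.initialProj n : X.L2 →L[ℂ] X.L2) * X.initialProj n = X.initialProj n :=
    congrArg Subtype.val (initialProj_mul_initialProj le_rfl)
  have hDQ : (X.initialProj n : X.L2 →L[ℂ] X.L2) * D = D * X.initialProj n :=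
    congrArg Subtype.val (commute_initialProj n D).eq
  have hSQ : S * (X.initialProj n : X.L2 →L[ℂ] X.L2) = X.initialProj n * S :=
    (hScomm _ hDQ.symm).eq
  rw [star_mul, hQ, hS, hSQ, mul_assoc, ← mul_assoc S, hSQ, mul_assoc, hSS, ← mul_assoc, hQQ, hDQ]

section Essential

variable {H : Type*} [NormedAddCommGroup H] [InnerProductSpace ℂ H] [CompleteSpace H]

/-- The span of the ranges of the projections of a representation of `ℂ[X]` onto finitely many
`X_i`.  On its closure the representation is determined by that on `ℓ²(X)`, and its orthogonal
complement is a representation of `C_c(∂G(X))`. -/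
def finitePart (π : X.roeAlgebra →⋆ₐ[ℂ] (H →L[ℂ] H)) : Submodule ℂ H :=
  ⨆ n, (π (X.initialProj n)).range

variable {π : X.roeAlgebra →⋆ₐ[ℂ] (H →L[ℂ] H)}

theorem mem_finitePart_iff {v : H} :
    v ∈ finitePart π ↔ ∃ n, v = π (X.initialProj n) v := by
  have hmono : Monotone fun n => (π (X.initialProj n)).range := by
    rintro m n hmn _ ⟨w, rfl⟩
    refine ⟨π (X.initialProj m) w, ?_⟩
    change π (X.initialProj n) (π (X.initialProj m) w) = π (X.initialProj m) w
    rw [← π.map_mul_apply, initialProj_mul_initialProj hmn]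
  rw [finitePart, Submodule.mem_iSup_of_directed _ hmono.directed_le]
  constructor
  · rintro ⟨n, w, rfl⟩
    refine ⟨n, ?_⟩
    change π (X.initialProj n) w = π (X.initialProj n) (π (X.initialProj n) w)
    rw [← π.map_mul_apply, initialProj_mul_initialProj le_rfl]
  · rintro ⟨n, h⟩
    exact ⟨n, v, h.symm⟩

theorem map_mem_finitePart (T : X.roeAlgebra) {v : H} (hv : v ∈ finitePart π) :
    π T v ∈ finitePart π := by
  obtain ⟨n, h⟩ := mem_finitePart_iff.1 hv
  refine mem_finitePart_iff.2 ⟨n, ?_⟩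
  rw [← π.map_mul_apply, (commute_initialProj n T).eq, π.map_mul_apply, ← h]

theorem map_mem_finitePart_orthogonal (T : X.roeAlgebra) {v : H} (hv : v ∈ (finitePart π)ᗮ) :
    π T v ∈ (finitePart π)ᗮ := by
  rw [Submodule.mem_orthogonal] at hv ⊢
  intro u hu
  rw [← π.inner_map_star_left]
  exact hv _ (map_mem_finitePart (star T) hu)

theorem map_initialProj_eq_zero (n : ℕ) {v : H} (hv : v ∈ (finitePart π)ᗮ) :
    π (X.initialProj n) v = 0 := by
  have h1 : π (X.initialProj n) v ∈ finitePart π := mem_finitePart_iff.2 ⟨n, by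
    rw [← π.map_mul_apply, initialProj_mul_initialProj le_rfl]⟩
  exact inner_self_eq_zero.1
    (Submodule.inner_right_of_mem_orthogonal h1 (map_mem_finitePart_orthogonal _ hv))

/-- If `D` is positive on `ℓ²(X)`, then it is positive on the closure of the finite part of every
representation. -/
theorem reApplyInnerSelf_nonneg_of_mem_closure {D : X.roeAlgebra}
    (hD : (D : X.L2 →L[ℂ] X.L2).IsPositive) {v : H}
    (hv : v ∈ (finitePart π).topologicalClosure) : 0 ≤ (π D).reApplyInnerSelf v := by
  have hclosed : IsClosed {v | 0 ≤ (π D).reApplyInnerSelf v} :=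
    isClosed_le continuous_const (π D).reApplyInnerSelf_continuous
  refine closure_minimal (fun v hv => ?_) hclosed hv
  obtain ⟨n, h⟩ := mem_finitePart_iff.1 hv
  obtain ⟨B, hB⟩ := exists_star_mul_self_eq hD n
  have h1 : π D v = π (star B) (π B v) := by
    nth_rewrite 1 [h]
    rw [← π.map_mul_apply, ← hB, π.map_mul_apply]
  rw [Set.mem_ofPred_eq, ContinuousLinearMap.reApplyInnerSelf_apply, h1, π.inner_map_star_left]
  exact inner_self_nonneg

/-- A subrepresentation that kills the operators supported on finitely many `X_i` factors through
`C_c(∂G(X))`. -/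
theorem exists_boundary_rep (W : Submodule ℂ H) [CompleteSpace W]
    (hW : ∀ T, ∀ v ∈ W, π T v ∈ W) (h0 : ∀ n, ∀ v ∈ W, π (X.initialProj n) v = 0) :
    ∃ σ : GroupoidAlgebra X.boundary →⋆ₐ[ℂ] (W →L[ℂ] W),
      ∀ T v, (σ (restrictHom X.boundary T) v : H) = π T v := by
  have hρ : ∀ n, π.subrep W hW (X.initialProj n) = 0 := fun n =>
    ContinuousLinearMap.ext fun v => Subtype.ext (h0 n v v.2)
  obtain ⟨σ, hσ⟩ := StarAlgHom.exists_comp_eq_of_surjective (C := W →L[ℂ] W)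
    (restrictHom X.boundary)
    (π.subrep W hW) (restrictHom_surjective _)
    fun T hT => map_eq_zero_of_restrictHom_eq_zero hρ hT
  refine ⟨σ, fun T v => ?_⟩
  rw [hσ]
  rfl

end Essential

theorem nonempty_pt : Nonempty X.Pt := by
  obtain ⟨i, hi⟩ := (X.card_tendsto.eventually_ge_atTop 1).exists
  have := (Nat.card_pos_iff.1 hi).1
  exact ⟨⟨i, Classical.arbitrary _⟩⟩

instance : Nontrivial X.L2 := by
  classical
  obtain ⟨x⟩ := nonempty_pt (X := X)
  refine ⟨delta x, 0, fun h => ?_⟩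
  have h1 : (delta x : X.L2) x = 0 := by
    rw [h]
    rfl
  simp [delta_apply] at h1

/-- An element of `ℂ[X]` is positive in every representation of `ℂ[X]` if and only if it is positive
on `ℓ²(X)` and its restriction to the boundary is positive in every representation of
`C_c(∂G(X))`. -/
theorem forall_isPositive_iff {D : X.roeAlgebra} :
    (∀ π : StarRep X.roeAlgebra, (π.hom D).IsPositive) ↔
      (D : X.L2 →L[ℂ] X.L2).IsPositive ∧
      ∀ π : StarRep (GroupoidAlgebra X.boundary),
        (π.hom (restrictHom X.boundary D)).IsPositive := by
  constructor
  · intro h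
    exact ⟨h { H := X.L2, hom := X.roeAlgebra.subtype },
      fun π => h { H := π.H, hom := π.hom.comp (restrictHom X.boundary) }⟩
  rintro ⟨hD, hB⟩ π
  have hsa : IsSelfAdjoint D := Subtype.ext hD.isSelfAdjoint
  obtain ⟨σ, hσ⟩ := exists_boundary_rep (finitePart π.hom)ᗮ
    (fun T _ hv => map_mem_finitePart_orthogonal T hv) fun n _ hv => map_initialProj_eq_zero n hv
  have hpos : ∀ v ∈ (finitePart π.hom)ᗮ, 0 ≤ (π.hom D).reApplyInnerSelf v := by
    intro v hv
    by_cases hv0 : v = 0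
    · simp [hv0, ContinuousLinearMap.reApplyInnerSelf_apply]
    · have : Nontrivial (finitePart π.hom)ᗮ := ⟨⟨v, hv⟩, 0, fun h => hv0 (congrArg Subtype.val h)⟩
      have h1 := (hB { H := (finitePart π.hom)ᗮ, hom := σ }).2 ⟨v, hv⟩
      change 0 ≤ RCLike.re (inner ℂ (σ (restrictHom X.boundary D) ⟨v, hv⟩ : π.H) v) at h1
      rwa [hσ] at h1
  exact ContinuousLinearMap.isPositive_of_orthogonal_decomposition (hsa.map π.hom)
    (fun v hv => map_mem_finitePart_orthogonal D hv)
    (fun v hv => reApplyInnerSelf_nonneg_of_mem_closure hD hv) hpos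

/-! ### Spectral gaps of the Laplace operator -/

theorem isSelfAdjoint_laplacian : IsSelfAdjoint X.laplacian := roeAlgebra_ext fun x y => by
  classical
  rw [entry_star]
  change starRingEnd ℂ (inner ℂ (delta y) (X.laplacianOp (delta x))) =
    inner ℂ (delta x) (X.laplacianOp (delta y))
  rw [inner_laplacianOp, inner_laplacianOp]
  by_cases h : x = y
  · subst h
    simp
  · rw [if_neg h, if_neg (Ne.symm h), X.G.adj_comm]
    split_ifs <;> simp

theorem isSelfAdjoint_laplacianOp : IsSelfAdjoint X.laplacianOp :=
  congrArg Subtype.val isSelfAdjoint_laplacian.star_eq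

theorem geometricGap_iff {c : ℝ} (hc : 0 < c) :
    X.GeometricGap c ↔ X.ExpanderGap c ∧ X.BoundaryGap c := by
  have hΔ : IsSelfAdjoint X.laplacian := isSelfAdjoint_laplacian
  have h1 : X.GeometricGap c ↔ ∀ π : StarRep X.roeAlgebra,
      (π.hom (X.laplacian * (X.laplacian - (c : ℂ) • 1) * X.laplacian)).IsPositive :=
    hasSpectralGap_toMaxCStar_iff hΔ hc
  have h2 : X.BoundaryGap c ↔ ∀ π : StarRep (GroupoidAlgebra X.boundary),
      (π.hom (restrictHom X.boundary
        (X.laplacian * (X.laplacian - (c : ℂ) • 1) * X.laplacian))).IsPositive := by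
    rw [map_mul, map_mul, map_sub, map_smul, map_one]
    exact hasSpectralGap_toMaxCStar_iff (hΔ.map (restrictHom X.boundary)) hc
  have h3 : X.ExpanderGap c ↔
      (X.laplacianOp * (X.laplacianOp - (c : ℂ) • 1) * X.laplacianOp).IsPositive :=
    hasSpectralGap_op_iff isSelfAdjoint_laplacianOp hc
  rw [h1, h2, h3]
  exact forall_isPositive_iff

theorem HasSpectralGap.mono {A : Type*} [Ring A] [Algebra ℂ A] {a : A} {c c' : ℝ}
    (h : HasSpectralGap a c) (hc : c' ≤ c) : HasSpectralGap a c' :=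
  h.trans (Set.union_subset_union_right _ (Set.image_mono (Set.Ici_subset_Ici.2 hc)))

end BoxSpace

end

theorem proposition3p1 (X : BoxSpace.{u}) :
    (X.GeometricPropertyT ↔ X.IsExpander ∧ X.BoundaryPropertyT) ∧
    ∀ c : ℝ, 0 < c → (X.GeometricGap c ↔ X.ExpanderGap c ∧ X.BoundaryGap c) := by
  refine ⟨⟨?_, ?_⟩, fun c hc => BoxSpace.geometricGap_iff hc⟩
  · rintro ⟨c, hc, h⟩
    obtain ⟨h1, h2⟩ := (BoxSpace.geometricGap_iff hc).1 h
    exact ⟨⟨c, hc, h1⟩, c, hc, h2⟩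
  · rintro ⟨⟨c, hc, h⟩, c', hc', h'⟩
    have hm : 0 < min c c' := lt_min hc hc'
    exact ⟨_, hm, (BoxSpace.geometricGap_iff hm).2
      ⟨BoxSpace.HasSpectralGap.mono h (min_le_left _ _),
        BoxSpace.HasSpectralGap.mono h' (min_le_right _ _)⟩⟩
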